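/- Let $0<I_1<I_2<I_3$ and $l>0$. Consider the sphere $p_1^2+p_2^2+p_3^2=2l$ in $\mathbb{R}^3$ with the symplectic form $$\omega=\frac{dp_1\wedge dp_2}{3p_3}=\frac{dp_2\wedge dp_3}{3p_1}=\frac{dp_3\wedge dp_1}{3p_2}$$ and the reduced Hamiltonian of the free rigid body $H=\frac12\left(\frac{p_1^2}{I_1}+\frac{p_2^2}{I_2}+\frac{p_3^2}{I_3}\right)$, and let $P_0$ be one of its two hyperbolic equilibria $(0,\pm\sqrt{2l},0)$. A Birkhoff normal form of $H$ at $P_0$ is a real function $\mathcal{H}$, analytic near $0$, such that $H=\mathcal{H}(XY)$ near $P_0$ for some real analytic local coordinates $(X,Y)$ on the sphere centred at $P_0$ with $\omega=dX\wedge dY$. Such a normal form exists, and one may take $\mathcal{H}'(0)>0$. Every normal form $\mathcal{H}$ at $P_0$ satisfies $\mathcal{H}(0)=l/I_2$ and $\mathcal{H}'(0)\neq 0$. If $\Phi_2$ is the local inverse of $\mathcal{H}$, defined near $l/I_2$ with $\Phi_2(l/I_2)=0$, and $\mathcal{H}'(0)>0$, then $\Phi_2$ is differentiable near $l/I_2$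 and, for all real $h$ sufficiently close to $l/I_2$, $$\Phi_2'(h)=\frac{\sqrt{-1}}{3\pi}\sqrt{\frac{2}{l}}\,\frac{1}{\sqrt{(d-c)(b-a)}}\,\mathcal{K}\!\left(\frac{(d-b)(a-c)}{(d-c)(a-b)}\right)=-\sqrt{-1}\,S(b,a,c,d),$$ where $a=\frac1{I_1}$, $b=\frac1{I_2}$, $c=\frac1{I_3}$, $d=\frac hl$, the square root of the negative number $(d-c)(b-a)$ is the principal one, $\sqrt{(d-c)(b-a)}=\sqrt{-1}\,\sqrt{(d-c)(a-b)}$, and $$\mathcal{K}(\lambda)=\int_0^1\frac{dx}{\sqrt{(1-x^2)(1-\lambda x^2)}},\qquad S(a,b,c,d)=-\frac{1}{3\pi}\sqrt{\frac 2l}\,\frac{1}{\sqrt{(d-c)(a-b)}}\,\mathcal{K}\!\left(\frac{(d-a)(b-c)}{(d-c)(b-a)}\right).$$ If instead $\mathcal{H}'(0)<0$, then $\Phi_2'(h)$ is the negative of this value (that is, the same formula with the other branch of $\sqrt{(d-c)(b-a)}$). -/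

import Mathlib

open scoped Matrix Topology

noncomputable section

namespace FreeRigidBody

/-- The Casimir function `L(P) = (p₁² + p₂² + p₃²) / 2` (half the squared angular momentum).
The coordinates `p₁, p₂, p₃` are `p 0, p 1, p 2`. -/
def casimir (p : Fin 3 → ℝ) : ℝ :=
  (p 0 ^ 2 + p 1 ^ 2 + p 2 ^ 2) / 2

/-- The Hamiltonian `H(P) = (p₁²/I₁ + p₂²/I₂ + p₃²/I₃) / 2` of the free rigid body with
inertia tensor `diag(I₁, I₂, I₃)`. -/
def hamiltonian (I₁ I₂ I₃ : ℝ) (p : Fin 3 → ℝ) : ℝ :=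
  (p 0 ^ 2 / I₁ + p 1 ^ 2 / I₂ + p 2 ^ 2 / I₃) / 2

/-- The symplectic form
`ω = dp₁ ∧ dp₂ / (3 p₃) = dp₂ ∧ dp₃ / (3 p₁) = dp₃ ∧ dp₁ / (3 p₂)`
on the spheres `L = l`, at the point `p`, evaluated on the vectors `v, w`. It is written as
`p · (v × w) / (3 |p|²)` in order to have one formula on the whole sphere; on tangent vectors
this agrees with each of the three expressions, see the three lemmas below. -/
def orbitForm (p v w : Fin 3 → ℝ) : ℝ :=
  (p ⬝ᵥ (v ⨯₃ w)) / (3 * (p ⬝ᵥ p))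

theorem orbitForm_eq_aux (p v w : Fin 3 → ℝ) (hv : p ⬝ᵥ v = 0) (hw : p ⬝ᵥ w = 0)
    (k : Fin 3) (hk : p k ≠ 0) :
    orbitForm p v w = (v ⨯₃ w) k / (3 * p k) := by
  have hpp : p ⬝ᵥ p ≠ 0 := by
    intro h
    rw [dotProduct_self_eq_zero] at h
    exact hk (by rw [h]; rfl)
  rw [orbitForm, div_eq_div_iff (by simpa using hpp) (by simpa using hk)]
  simp only [cross_apply, dotProduct, Fin.sum_univ_three] at *
  fin_cases k
  · simp
    linear_combination (3 * (p 1 * v 2 - p 2 * v 1)) * hw - (3 * (p 1 * w 2 - p 2 * w 1)) * hv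
  · simp
    linear_combination (3 * (p 2 * v 0 - p 0 * v 2)) * hw - (3 * (p 2 * w 0 - p 0 * w 2)) * hv
  · simp
    linear_combination (3 * (p 0 * v 1 - p 1 * v 0)) * hw - (3 * (p 0 * w 1 - p 1 * w 0)) * hv

/-- On the tangent plane, `ω = dp₁ ∧ dp₂ / (3 p₃)` where `p₃ ≠ 0`. -/
theorem orbitForm_eq_dp₁_dp₂ (p v w : Fin 3 → ℝ) (hv : p ⬝ᵥ v = 0) (hw : p ⬝ᵥ w = 0)
    (hp : p 2 ≠ 0) : orbitForm p v w = (v 0 * w 1 - v 1 * w 0) / (3 * p 2) := by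
  rw [orbitForm_eq_aux p v w hv hw 2 hp]; simp [cross_apply]

/-- On the tangent plane, `ω = dp₂ ∧ dp₃ / (3 p₁)` where `p₁ ≠ 0`. -/
theorem orbitForm_eq_dp₂_dp₃ (p v w : Fin 3 → ℝ) (hv : p ⬝ᵥ v = 0) (hw : p ⬝ᵥ w = 0)
    (hp : p 0 ≠ 0) : orbitForm p v w = (v 1 * w 2 - v 2 * w 1) / (3 * p 0) := by
  rw [orbitForm_eq_aux p v w hv hw 0 hp]; simp [cross_apply]

/-- On the tangent plane, `ω = dp₃ ∧ dp₁ / (3 p₂)` where `p₂ ≠ 0`. -/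
theorem orbitForm_eq_dp₃_dp₁ (p v w : Fin 3 → ℝ) (hv : p ⬝ᵥ v = 0) (hw : p ⬝ᵥ w = 0)
    (hp : p 1 ≠ 0) : orbitForm p v w = (v 2 * w 0 - v 0 * w 2) / (3 * p 1) := by
  rw [orbitForm_eq_aux p v w hv hw 1 hp]; simp [cross_apply]

/-- `ψ` is (the inverse of) a system of real analytic Darboux coordinates `(X, Y)`, centred at
`P₀`, on the sphere `L = l`: an analytic parametrization `(X, Y) ↦ ψ (X, Y)` of the sphere near
`ψ (0, 0) = P₀` with `ψ^* ω = dX ∧ dY`. (The last condition makes `ψ` an immersion at each point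
near the origin, hence a local analytic diffeomorphism onto the sphere.) -/
structure IsDarbouxParametrization (l : ℝ) (P₀ : Fin 3 → ℝ) (ψ : ℝ × ℝ → Fin 3 → ℝ) : Prop where
  analyticAt : AnalyticAt ℝ ψ 0
  map_zero : ψ 0 = P₀
  casimir_eq : ∀ᶠ z in 𝓝 (0 : ℝ × ℝ), casimir (ψ z) = l
  pullback_eq : ∀ᶠ z in 𝓝 (0 : ℝ × ℝ),
    orbitForm (ψ z) (fderiv ℝ ψ z (1, 0)) (fderiv ℝ ψ z (0, 1)) = 1

/-- `𝓗` is a (convergent) Birkhoff normal form, of hyperbolic type, of the reduced Hamiltonian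
`H|_{L = l}` at the point `P₀`: `𝓗` is real analytic near `0`, and `H = 𝓗(XY)` near `P₀` in
suitable real analytic Darboux coordinates `(X, Y)` centred at `P₀`. Here `H` is the energy itself,
so that `𝓗(0) = H(P₀)`. -/
def IsHyperbolicBirkhoffNormalForm (I₁ I₂ I₃ l : ℝ) (P₀ : Fin 3 → ℝ) (𝓗 : ℝ → ℝ) : Prop :=
  AnalyticAt ℝ 𝓗 0 ∧
    ∃ ψ : ℝ × ℝ → Fin 3 → ℝ, IsDarbouxParametrization l P₀ ψ ∧
      ∀ᶠ z in 𝓝 (0 : ℝ × ℝ), hamiltonian I₁ I₂ I₃ (ψ z) = 𝓗 (z.1 * z.2)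

/-- The complete elliptic integral of the first kind, as a function of the parameter `t`
(the square of the modulus), for real `t < 1`. -/
def ellipticK (t : ℝ) : ℝ :=
  ∫ x in (0 : ℝ)..1, 1 / √((1 - x ^ 2) * (1 - t * x ^ 2))

/-- The function
`S(a,b,c,d) = -(1/(3π)) √(2/l) ((d-c)(a-b))^(-1/2) K((d-a)(b-c) / ((d-c)(b-a)))`,
with the principal branch of the complex square root. -/
def S (l a b c d : ℝ) : ℂ :=
  -(1 / (3 * (Real.pi : ℂ))) * (√(2 / l) : ℝ) *
    (1 / Complex.sqrt (((d - c) * (a - b) : ℝ) : ℂ)) *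
    (ellipticK ((d - a) * (b - c) / ((d - c) * (b - a))) : ℝ)

end FreeRigidBody

end

namespace FreeRigidBody

open Filter Set
open scoped ContDiff

/-! Near the equilibrium the sphere has coordinates `(x, y)` (`sphereChart`) in which H = l/I₂ + xy
exactly and ω = g dx ∧ dy, with g = c / √(m − βxy − α(x² + y²)). The field x∂x − y∂y preserves xy,
and x^i y^j is an eigenvector of it with eigenvalue i − j. Hence g = P(xy) + (x∂x − y∂y)Ψ with Ψ
analytic: the off-diagonal monomials are derivatives, and the diagonal ones make up P
(`exists_modelDensity_decomposition`). Equivalently, P(s) is the mean of g over the vanishing cycle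
x = √s e^{iθ}, y = √s e^{−iθ}, which is a complete elliptic integral (`modelPeriod_eq_ellipticK`).

Existence: let T' = P, T(0) = 0 and T(s) = s A(s)². With φ = Ψ/P(xy), the functions X = x A e^φ and
Y = y A e^{−φ} satisfy XY = T(xy) and dX ∧ dY = g dx ∧ dy. So H = l/I₂ + T⁻¹(XY)
(`exists_isochore_coordinates`).

Rigidity: for any normal form put E = 𝓗 − l/I₂, so that xy = E(XY). On the hyperbola XY = s the flow
of X∂X − Y∂Y goes from (s/δ, δ) to (δ, s/δ) in time log(δ²/s). Computing the same time from the
decomposition of g shows that (E' P(E) − σ) log s agrees, for small s > 0, with a function analytic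
at 0. As the logarithm is not a quotient of analytic functions, E' P(E) = σ, where σ = ±1 according
to which of X, Y corresponds to x (`deriv_mul_period_eq_or_neg`).

Inverting, Φ₂'(h) = σ P(h − l/I₂), and P(0) > 0 makes σ the sign of 𝓗'(0). -/

/-! ### Power series in one and two variables. -/

theorem exists_hasSum_of_analyticAt {f : ℝ → ℝ} (hf : AnalyticAt ℝ f 0) :
    ∃ (b : ℕ → ℝ) (C R : ℝ), 0 < C ∧ 0 < R ∧ (∀ n, |b n| ≤ C * R ^ n) ∧
      ∀ᶠ z in 𝓝 (0 : ℝ), HasSum (fun n => b n * z ^ n) (f z) := by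
  obtain ⟨p, hp⟩ := hf
  obtain ⟨C, R, hC, hR, hb⟩ := p.le_mul_pow_of_radius_pos hp.radius_pos
  refine ⟨p.coeff, C, R, hC, hR, fun n => ?_, ?_⟩
  · have := hb n
    rwa [FormalMultilinearSeries.norm_apply_eq_norm_coef] at this
  · filter_upwards [hasFPowerSeriesAt_iff'.1 hp] with z hz
    simpa [mul_comm] using hz

/-- A real analytic function has a real analytic primitive. -/
theorem exists_analyticAt_primitive {f : ℝ → ℝ} (hf : AnalyticAt ℝ f 0) :
    ∃ F : ℝ → ℝ, AnalyticAt ℝ F 0 ∧ F 0 = 0 ∧ ∀ᶠ z in 𝓝 (0 : ℝ), HasDerivAt F (f z) z := by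
  obtain ⟨b, C, R, hC, hR, hb, hsum⟩ := exists_hasSum_of_analyticAt hf
  let c : ℕ → ℝ := fun n => if n = 0 then 0 else b (n - 1) / n
  let q : FormalMultilinearSeries ℝ ℝ ℝ := FormalMultilinearSeries.ofScalars ℝ c
  have hcb : ∀ n, |c n| ≤ (C / R) * R ^ n := by
    intro n
    rcases n with _ | n
    · simp only [c, if_true, abs_zero]; positivity
    · have h1 : |c (n + 1)| ≤ |b n| := by
        simp only [c, Nat.add_eq_zero_iff, one_ne_zero, and_false, if_false, Nat.add_sub_cancel,
          abs_div]
        apply div_le_self (abs_nonneg _)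
        rw [abs_of_nonneg (by positivity)]
        push_cast
        linarith [(Nat.cast_nonneg n : (0 : ℝ) ≤ n)]
      calc |c (n + 1)| ≤ C * R ^ n := h1.trans (hb n)
        _ = (C / R) * R ^ (n + 1) := by rw [pow_succ]; field_simp
  have hrad : 0 < q.radius := by
    have := q.le_radius_of_bound (C / R) (r := ⟨R⁻¹, by positivity⟩) (fun n => by
      have : ‖q n‖ = |c n| := by simp [q]
      rw [this]
      calc |c n| * (R⁻¹) ^ n ≤ (C / R) * R ^ n * (R⁻¹) ^ n := by gcongr; exact hcb n
        _ = C / R := by rw [mul_assoc, ← mul_pow, mul_inv_cancel₀ hR.ne', one_pow, mul_one])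
    refine lt_of_lt_of_le ?_ this
    exact ENNReal.coe_pos.2 (show (0 : ℝ) < R⁻¹ from inv_pos.2 hR)
  have hF := q.hasFPowerSeriesOnBall hrad
  refine ⟨q.sum, hF.analyticAt, ?_, ?_⟩
  · have := hF.coeff_zero (fun _ => 0)
    rw [← this]
    simp [q, c]
  · have hF' := hF.fderiv.hasFPowerSeriesAt
    have hdiff : ∀ᶠ z in 𝓝 (0 : ℝ), AnalyticAt ℝ q.sum z := hF.analyticAt.eventually_analyticAt
    filter_upwards [hsum, hasFPowerSeriesAt_iff'.1 hF', hdiff] with z h1 h2 h3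
    have h4 : HasSum (fun n => b n * z ^ n) (fderiv ℝ q.sum z 1) := by
      have := (ContinuousLinearMap.apply ℝ ℝ (1 : ℝ)).hasSum h2
      convert! this using 2 with n
      simp only [ContinuousLinearMap.apply_apply, smul_apply, sub_zero,
        FormalMultilinearSeries.derivSeries_coeff_one, q, FormalMultilinearSeries.coeff_ofScalars,
        c, smul_eq_mul, nsmul_eq_mul]
      simp
      field_simp
    have h5 := h3.differentiableAt.hasDerivAt
    rwa [← fderiv_apply_one_eq_deriv, h4.unique h1] at h5

/-- The monomial `x ^ j * y ^ (N - j)` (for `j ≤ N`) as a multilinear map. -/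
def monomialMap (N j : ℕ) : ContinuousMultilinearMap ℝ (fun _ : Fin N => ℝ × ℝ) ℝ :=
  (ContinuousMultilinearMap.mkPiAlgebra ℝ (Fin N) ℝ).compContinuousLinearMap
    (fun i => if (i : ℕ) < j then ContinuousLinearMap.fst ℝ ℝ ℝ else ContinuousLinearMap.snd ℝ ℝ ℝ)

theorem monomialMap_apply (N j : ℕ) (hj : j ≤ N) (z : ℝ × ℝ) :
    monomialMap N j (fun _ => z) = z.1 ^ j * z.2 ^ (N - j) := by
  have h : ∀ i : Fin N, (if (i : ℕ) < j then ContinuousLinearMap.fst ℝ ℝ ℝ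
      else ContinuousLinearMap.snd ℝ ℝ ℝ) z = if (i : ℕ) < j then z.1 else z.2 := by
    intro i; split_ifs <;> rfl
  simp only [monomialMap, ContinuousMultilinearMap.compContinuousLinearMap_apply,
    ContinuousMultilinearMap.mkPiAlgebra_apply, h]
  rw [Fin.prod_univ_eq_prod_range (fun i => if i < j then z.1 else z.2) N,
    ← Finset.prod_range_mul_prod_Ico _ hj]
  congr 1
  · rw [Finset.prod_congr rfl (g := fun _ => z.1)
      (fun i hi => if_pos (Finset.mem_range.1 hi))]
    simp
  · rw [Finset.prod_congr rfl (g := fun _ => z.2)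
      (fun i hi => if_neg (not_lt.2 (Finset.mem_Ico.1 hi).1))]
    simp

theorem norm_monomialMap_le (N j : ℕ) : ‖monomialMap N j‖ ≤ 1 := by
  refine (ContinuousMultilinearMap.norm_compContinuousLinearMap_le _ _).trans ?_
  rw [ContinuousMultilinearMap.norm_mkPiAlgebra, one_mul]
  refine Finset.prod_le_one (fun _ _ => norm_nonneg _) (fun i _ => ?_)
  split_ifs
  · exact ContinuousLinearMap.norm_fst_le ..
  · exact ContinuousLinearMap.norm_snd_le ..

/-- A double power series with geometrically bounded homogeneous parts has an analytic sum. -/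
theorem analyticAt_tsum_homogeneous (a : ℕ → ℕ → ℝ) (C R : ℝ) (hR : 0 < R)
    (ha : ∀ n, ∑ k ∈ Finset.range (n + 1), |a n k| ≤ C * R ^ n) :
    AnalyticAt ℝ (fun z : ℝ × ℝ =>
      ∑' n, ∑ k ∈ Finset.range (n + 1), a n k * (z.1 ^ k * z.2 ^ (n - k))) 0 := by
  let q : FormalMultilinearSeries ℝ (ℝ × ℝ) ℝ := fun n =>
    ∑ k ∈ Finset.range (n + 1), a n k • monomialMap n k
  have hq : ∀ n, ‖q n‖ ≤ C * R ^ n := fun n => by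
    refine (norm_sum_le _ _).trans ((Finset.sum_le_sum fun k _ => ?_).trans (ha n))
    rw [norm_smul, Real.norm_eq_abs]
    exact mul_le_of_le_one_right (abs_nonneg _) (norm_monomialMap_le n k)
  have hrad : 0 < q.radius := by
    have := q.le_radius_of_bound C (r := ⟨R⁻¹, by positivity⟩) (fun n => by
      calc ‖q n‖ * (R⁻¹) ^ n ≤ C * R ^ n * (R⁻¹) ^ n := by gcongr; exact hq n
        _ = C := by rw [mul_assoc, ← mul_pow, mul_inv_cancel₀ hR.ne', one_pow, mul_one])
    refine lt_of_lt_of_le ?_ this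
    exact ENNReal.coe_pos.2 (show (0 : ℝ) < R⁻¹ from inv_pos.2 hR)
  have hs := (q.hasFPowerSeriesOnBall hrad).analyticAt
  convert! hs using 2 with z
  simp only [FormalMultilinearSeries.sum]
  refine tsum_congr fun n => ?_
  simp only [q, sum_apply, smul_apply,
    smul_eq_mul]
  refine Finset.sum_congr rfl fun k hk => ?_
  rw [monomialMap_apply n k (Nat.lt_succ_iff.1 (Finset.mem_range.1 hk))]

/-! ### Averages and the cohomological equation. -/

/-- The coefficient of `x ^ n * y ^ n` in `(x ^ 2 + y ^ 2) ^ n`. -/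
def diagCoeff (n : ℕ) : ℝ := if Even n then (n.choose (n / 2) : ℝ) else 0

/-- Only the constant term of (e^{iθ} + e^{−iθ})^n has a nonzero mean. The induction matches the
reduction formula for powers of the cosine with the recursion of the central binomial coefficients.
-/
theorem integral_two_mul_cos_pow (n : ℕ) :
    ∫ θ in (0 : ℝ)..Real.pi, (2 * Real.cos θ) ^ n = Real.pi * diagCoeff n := by
  induction n using Nat.twoStepInduction with
  | zero => simp [diagCoeff]
  | one => simp [diagCoeff]
  | more n ih _ =>
    simp only [mul_pow, intervalIntegral.integral_const_mul] at ih ⊢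
    rw [integral_cos_pow, pow_add, show (2 : ℝ) ^ n * 2 ^ 2 * ((Real.cos Real.pi ^ (n + 1) *
      Real.sin Real.pi - Real.cos 0 ^ (n + 1) * Real.sin 0) / (n + 2) + (n + 1) / (n + 2) *
      ∫ x in (0 : ℝ)..Real.pi, Real.cos x ^ n) = 4 * (n + 1) / (n + 2) *
      (2 ^ n * ∫ x in (0 : ℝ)..Real.pi, Real.cos x ^ n) by simp; ring, ih]
    by_cases h : Even n
    · obtain ⟨m, rfl⟩ := h
      have h1 : (m + m) / 2 = m := by omega
      have h2 : (m + m + 2) / 2 = m + 1 := by omega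
      have h3 : Even (m + m + 2) := ⟨m + 1, by ring⟩
      have h4 := Nat.succ_mul_centralBinom_succ m
      rw [Nat.centralBinom, Nat.centralBinom] at h4
      rw [diagCoeff, diagCoeff, if_pos ⟨m, rfl⟩, if_pos h3, h1, h2,
        show m + m + 2 = 2 * (m + 1) by ring, ← two_mul]
      have h5 : ((m : ℝ) + 1) * ((2 * (m + 1)).choose (m + 1) : ℝ) =
          2 * (2 * m + 1) * ((2 * m).choose m : ℝ) := by exact_mod_cast h4
      push_cast
      field_simp
      linear_combination -2 * h5
    · have h3 : ¬ Even (n + 2) := by simpa [Nat.even_add] using h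
      simp [diagCoeff, h, h3]

/-- Cosine averages of a power series. -/
theorem hasSum_average {f : ℝ → ℝ} {b : ℕ → ℝ} {C R : ℝ} (hC : 0 < C) (hR : 0 < R)
    (hb : ∀ n, |b n| ≤ C * R ^ n) (hf : ∀ᶠ z in 𝓝 (0 : ℝ), HasSum (fun n => b n * z ^ n) (f z)) :
    ∀ᶠ s in 𝓝 (0 : ℝ), HasSum (fun n => b n * diagCoeff n * s ^ n)
      (1 / Real.pi * ∫ θ in (0 : ℝ)..Real.pi, f (2 * s * Real.cos θ)) := by
  obtain ⟨ε, hε, hf⟩ := Metric.eventually_nhds_iff.1 hf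
  -- The first bound keeps 2s cos θ in the domain of the series, the second makes the series
  -- geometric with ratio at most 1/2.
  have hev : ∀ᶠ s in 𝓝 (0 : ℝ), |s| < min (ε / 2) (1 / (4 * R)) := by
    have : 0 < min (ε / 2) (1 / (4 * R)) := by positivity
    filter_upwards [Metric.ball_mem_nhds (0 : ℝ) this] with s hs
    simpa using hs
  filter_upwards [hev] with s hs
  have hs1 : |s| < ε / 2 := hs.trans_le (min_le_left _ _)
  have hs2 : |s| < 1 / (4 * R) := hs.trans_le (min_le_right _ _)
  have hle : ∀ θ, |2 * s * Real.cos θ| ≤ 2 * |s| := fun θ => by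
    rw [abs_mul, abs_mul, abs_two]
    exact mul_le_of_le_one_right (by positivity) (Real.abs_cos_le_one θ)
  have hR4 : R * (2 * |s|) ≤ 1 / 2 := by
    rw [lt_div_iff₀ (by positivity)] at hs2
    linarith
  have key := intervalIntegral.hasSum_integral_of_dominated_convergence
    (μ := MeasureTheory.volume) (a := 0) (b := Real.pi)
    (F := fun (n : ℕ) θ => b n * (2 * s * Real.cos θ) ^ n)
    (f := fun θ => f (2 * s * Real.cos θ)) (fun n _ => C * (1 / 2) ^ n)
    (fun n => (by fun_prop : Continuous fun θ => b n * (2 * s * Real.cos θ) ^ n).aestronglyMeasurable)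
    (fun n => Eventually.of_forall fun θ _ => by
      rw [Real.norm_eq_abs, abs_mul, abs_pow]
      calc |b n| * |2 * s * Real.cos θ| ^ n ≤ C * R ^ n * (2 * |s|) ^ n := by
            gcongr
            · exact hb n
            · exact hle θ
        _ = C * (R * (2 * |s|)) ^ n := by rw [mul_pow R]; ring
        _ ≤ C * (1 / 2) ^ n := by gcongr)
    (Eventually.of_forall fun θ _ =>
      (summable_geometric_of_lt_one (by norm_num) (by norm_num)).mul_left C)
    (by simp)
    (Eventually.of_forall fun θ _ => hf (by
      rw [Real.dist_0_eq_abs]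
      linarith [hle θ]))
  have key2 := key.mul_left (1 / Real.pi)
  convert! key2 using 2 with n
  have : ∀ θ, b n * (2 * s * Real.cos θ) ^ n = b n * s ^ n * (2 * Real.cos θ) ^ n := fun θ => by
    rw [show 2 * s * Real.cos θ = s * (2 * Real.cos θ) by ring, mul_pow]; ring
  simp only [this, intervalIntegral.integral_const_mul, integral_two_mul_cos_pow]
  field_simp

/-- Derivative along the flow of the vector field `x ∂/∂x - y ∂/∂y`. -/
theorem hasDerivAt_comp_hyperbolic_flow {Θ : ℝ × ℝ → ℝ} {w : ℝ × ℝ}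
    (hΘ : DifferentiableAt ℝ Θ w) :
    HasDerivAt (fun t : ℝ => Θ (w.1 * Real.exp t, w.2 * Real.exp (-t)))
      (fderiv ℝ Θ w (w.1, -w.2)) 0 := by
  have h1 : HasDerivAt (fun t : ℝ => (w.1 * Real.exp t, w.2 * Real.exp (-t))) (w.1, -w.2) 0 := by
    have e1 := (Real.hasDerivAt_exp (0 : ℝ)).const_mul w.1
    have e2 := ((hasDerivAt_neg (0 : ℝ)).exp).const_mul w.2
    simpa using e1.prodMk e2
  have h2 : HasFDerivAt Θ (fderiv ℝ Θ w) (w.1 * Real.exp 0, w.2 * Real.exp (-0)) := by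
    simpa using hΘ.hasFDerivAt
  exact h2.comp_hasDerivAt (0 : ℝ) h1

/-- Solution of `X ∂Θ/∂X - Y ∂Θ/∂Y = f (X + Y)` up to a function of `X * Y`. -/
theorem exists_linear_cohomological_solution {f : ℝ → ℝ} {b : ℕ → ℝ} {C R : ℝ}
    (hR : 0 < R) (hb : ∀ n, |b n| ≤ C * R ^ n)
    (hf : ∀ᶠ z in 𝓝 (0 : ℝ), HasSum (fun n => b n * z ^ n) (f z)) :
    ∃ Θ : ℝ × ℝ → ℝ, AnalyticAt ℝ Θ 0 ∧ ∀ᶠ w in 𝓝 (0 : ℝ × ℝ),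
      HasSum (fun n => b n * diagCoeff n * (w.1 ^ (n / 2) * w.2 ^ (n / 2)))
        (f (w.1 + w.2) - fderiv ℝ Θ w (w.1, -w.2)) := by
  -- The monomial X^k Y^(n−k) has eigenvalue 2k − n, so the equation is solved by division. The
  -- resonant index 2k = n is dropped from both `a` and the right-hand side `d`.
  let a : ℕ → ℕ → ℝ := fun n k => if 2 * k = n then 0 else b n * n.choose k / (2 * k - n)
  let d : ℕ → ℕ → ℝ := fun n k => if 2 * k = n then 0 else b n * n.choose k
  have had : ∀ n k, a n k * (2 * k - n) = d n k := fun n k => by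
    simp only [a, d]
    split_ifs with h
    · simp
    · have : (2 * k - n : ℝ) ≠ 0 := sub_ne_zero.2 (by exact_mod_cast h)
      field_simp
  have hsumc : ∀ n, ∑ k ∈ Finset.range (n + 1), |b n| * (n.choose k : ℝ) ≤ C * (2 * R) ^ n := by
    intro n
    rw [← Finset.mul_sum]
    have : ∑ k ∈ Finset.range (n + 1), (n.choose k : ℝ) = 2 ^ n := by
      exact_mod_cast Nat.sum_range_choose n
    rw [this, mul_pow, mul_comm ((2 : ℝ) ^ n), ← mul_assoc]
    gcongr
    exact hb n
  have hdb : ∀ n k, |d n k| ≤ |b n| * (n.choose k : ℝ) := fun n k => by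
    simp only [d]
    split_ifs
    · rw [abs_zero]; positivity
    · rw [abs_mul, Nat.abs_cast]
  have hab : ∀ n k, |a n k| ≤ |b n| * (n.choose k : ℝ) := fun n k => by
    simp only [a]
    split_ifs with h
    · rw [abs_zero]; positivity
    · rw [abs_div, abs_mul, Nat.abs_cast]
      apply div_le_self (by positivity)
      -- There are no small divisors: a nonzero integer has absolute value at least 1.
      have : (1 : ℤ) ≤ |2 * (k : ℤ) - n| := Int.one_le_abs (sub_ne_zero.2 (by exact_mod_cast h))
      exact_mod_cast this
  let Θ : ℝ × ℝ → ℝ := fun z =>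
      ∑' n, ∑ k ∈ Finset.range (n + 1), a n k * (z.1 ^ k * z.2 ^ (n - k))
  have hΘ : AnalyticAt ℝ Θ 0 := analyticAt_tsum_homogeneous a C (2 * R) (by positivity)
    (fun n => (Finset.sum_le_sum fun k _ => hab n k).trans (hsumc n))
  refine ⟨Θ, hΘ, ?_⟩
  -- The sum of binomial coefficients contributes 2R per degree and the flow for |t| < 1 at most e <
  -- 3, so this radius gives the ratio 2R · 3/(12R) = 1/2.
  have hev1 : ∀ᶠ w in 𝓝 (0 : ℝ × ℝ), |w.1| < 1 / (12 * R) ∧ |w.2| < 1 / (12 * R) := by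
    have : 0 < 1 / (12 * R) := by positivity
    filter_upwards [Metric.ball_mem_nhds (0 : ℝ × ℝ) this] with w hw
    rw [mem_ball_zero_iff, Prod.norm_def, max_lt_iff] at hw
    exact hw
  have hev2 : ∀ᶠ w in 𝓝 (0 : ℝ × ℝ), HasSum (fun n => b n * (w.1 + w.2) ^ n) (f (w.1 + w.2)) := by
    have : Tendsto (fun w : ℝ × ℝ => w.1 + w.2) (𝓝 0) (𝓝 0) := by
      have : Continuous fun w : ℝ × ℝ => w.1 + w.2 := by fun_prop
      simpa using this.tendsto (0 : ℝ × ℝ)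
    exact this.eventually hf
  filter_upwards [hev1, hev2, hΘ.eventually_analyticAt] with w hw hfw hΘw
  -- terms along the flow
  let g : ℕ → ℝ → ℝ := fun n t =>
    ∑ k ∈ Finset.range (n + 1), a n k * (w.1 ^ k * w.2 ^ (n - k) * Real.exp ((2 * k - n) * t))
  let g' : ℕ → ℝ → ℝ := fun n t =>
    ∑ k ∈ Finset.range (n + 1), d n k * (w.1 ^ k * w.2 ^ (n - k) * Real.exp ((2 * k - n) * t))
  have hg : ∀ n t, HasDerivAt (g n) (g' n t) t := fun n t => by
    refine HasDerivAt.fun_sum fun k _ => ?_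
    have h1 : HasDerivAt (fun t : ℝ => Real.exp ((2 * k - n) * t))
        (Real.exp ((2 * k - n) * t) * (2 * k - n)) t := by
      simpa using ((hasDerivAt_id t).const_mul (2 * (k : ℝ) - n)).exp
    have := (h1.const_mul (w.1 ^ k * w.2 ^ (n - k))).const_mul (a n k)
    refine this.congr_deriv ?_
    rw [← had]; ring
  have hbd : ∀ (e : ℕ → ℕ → ℝ), (∀ n k, |e n k| ≤ |b n| * (n.choose k : ℝ)) → ∀ n,
      ∀ t ∈ Ioo (-1 : ℝ) 1, ‖∑ k ∈ Finset.range (n + 1),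
        e n k * (w.1 ^ k * w.2 ^ (n - k) * Real.exp ((2 * k - n) * t))‖ ≤ C * (1 / 2) ^ n := by
    intro e he n t ht
    have h1 : ∀ k ∈ Finset.range (n + 1),
        |e n k * (w.1 ^ k * w.2 ^ (n - k) * Real.exp ((2 * k - n) * t))| ≤
        |b n| * (n.choose k : ℝ) * (1 / (12 * R) * 3) ^ n := by
      intro k hk
      have hk : k ≤ n := Nat.lt_succ_iff.1 (Finset.mem_range.1 hk)
      have hk' : (k : ℝ) ≤ n := by exact_mod_cast hk
      rw [abs_mul, abs_mul, abs_mul, abs_pow, abs_pow, Real.abs_exp, mul_pow]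
      have e1 : Real.exp ((2 * k - n) * t) ≤ 3 ^ n := by
        calc Real.exp ((2 * k - n) * t) ≤ Real.exp (n * 1) := by
              apply Real.exp_le_exp.2
              have h0 : (0 : ℝ) ≤ k := Nat.cast_nonneg k
              have : |(2 * k - n : ℝ) * t| ≤ n * 1 := by
                rw [abs_mul]
                gcongr
                · rw [abs_le]; constructor <;> linarith
                · exact (abs_lt.2 ht).le
              exact (le_abs_self _).trans this
          _ = Real.exp 1 ^ n := by rw [← Real.exp_nat_mul]
          _ ≤ 3 ^ n := by gcongr; exact Real.exp_one_lt_three.le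
      have e2 : |w.1| ^ k * |w.2| ^ (n - k) ≤ (1 / (12 * R)) ^ n := by
        calc |w.1| ^ k * |w.2| ^ (n - k) ≤ (1 / (12 * R)) ^ k * (1 / (12 * R)) ^ (n - k) := by
              gcongr
              · exact hw.1.le
              · exact hw.2.le
          _ = (1 / (12 * R)) ^ n := by rw [← pow_add, Nat.add_sub_cancel' hk]
      gcongr
      exact he n k
    refine (norm_sum_le _ _).trans ((Finset.sum_le_sum h1).trans ?_)
    rw [← Finset.sum_mul]
    calc _ ≤ C * (2 * R) ^ n * (1 / (12 * R) * 3) ^ n := by gcongr; exact hsumc n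
      _ = C * (1 / 2) ^ n := by
        rw [mul_assoc, ← mul_pow]; congr 2; field_simp; norm_num
  have hgeo : Summable fun n : ℕ => C * (1 / 2 : ℝ) ^ n :=
    (summable_geometric_of_lt_one (by norm_num) (by norm_num)).mul_left C
  have h0 : (0 : ℝ) ∈ Ioo (-1 : ℝ) 1 := by norm_num
  -- Along the flow each monomial is multiplied by an exponential in t, so differentiating term by
  -- term in the single variable t gives the directional derivative of `Θ`.
  have hder := hasDerivAt_tsum_of_isPreconnected hgeo isOpen_Ioo isPreconnected_Ioo
    (fun n t _ => hg n t) (fun n t ht => hbd d hdb n t ht) h0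
    (Summable.of_norm_bounded hgeo fun n => hbd a hab n 0 h0) h0
  have hsum' : HasSum (fun n => g' n 0) (∑' n, g' n 0) :=
    (Summable.of_norm_bounded hgeo fun n => hbd d hdb n 0 h0).hasSum
  have hcurve := hasDerivAt_comp_hyperbolic_flow hΘw.differentiableAt
  have heq : (fun t : ℝ => Θ (w.1 * Real.exp t, w.2 * Real.exp (-t))) = fun t => ∑' n, g n t := by
    funext t
    simp only [Θ, g]
    refine tsum_congr fun n => Finset.sum_congr rfl fun k hk => ?_
    have hk : k ≤ n := Nat.lt_succ_iff.1 (Finset.mem_range.1 hk)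
    rw [mul_pow, mul_pow, ← Real.exp_nat_mul, ← Real.exp_nat_mul,
      show (2 * k - n : ℝ) * t = k * t + (n - k : ℕ) * -t by rw [Nat.cast_sub hk]; ring,
      Real.exp_add]
    ring
  rw [heq] at hcurve
  rw [hcurve.unique hder]
  convert! hfw.sub hsum' using 2 with n
  have hterm : ∀ k, b n * (w.1 ^ k * w.2 ^ (n - k) * n.choose k) -
      d n k * (w.1 ^ k * w.2 ^ (n - k) * Real.exp ((2 * k - n) * 0)) =
      if k + k = n then b n * n.choose k * (w.1 ^ k * w.2 ^ (n - k)) else 0 := by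
    intro k
    rw [mul_zero, Real.exp_zero, mul_one, ← two_mul]
    simp only [d]
    split_ifs <;> ring
  simp only [g']
  rw [add_pow, Finset.mul_sum, ← Finset.sum_sub_distrib, Finset.sum_congr rfl fun k _ => hterm k]
  by_cases hn : Even n
  · obtain ⟨m, rfl⟩ := hn
    have h2 : (m + m) / 2 = m := by omega
    rw [Finset.sum_eq_single m, if_pos rfl, diagCoeff, if_pos ⟨m, rfl⟩, h2,
      Nat.add_sub_cancel]
    · intro k _ hk
      rw [if_neg (by omega)]
    · intro h
      exact absurd (Finset.mem_range.2 (by omega)) h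
  · rw [diagCoeff, if_neg hn, Finset.sum_eq_zero]
    · ring
    · intro k _
      rw [if_neg (fun h => hn ⟨k, h.symm⟩)]

/-- Solution of `x ∂Θ/∂x - y ∂Θ/∂y = f (x ^ 2 + y ^ 2)` up to a function of `x * y`, which is an
average of `f`. -/
theorem exists_cohomological_solution {f : ℝ → ℝ} (hf : AnalyticAt ℝ f 0) :
    ∃ Θ : ℝ × ℝ → ℝ, AnalyticAt ℝ Θ 0 ∧ ∀ᶠ z in 𝓝 (0 : ℝ × ℝ),
      fderiv ℝ Θ z (z.1, -z.2) = f (z.1 ^ 2 + z.2 ^ 2) -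
        1 / Real.pi * ∫ θ in (0 : ℝ)..Real.pi, f (2 * (z.1 * z.2) * Real.cos θ) := by
  obtain ⟨b, C, R, hC, hR, hb, hsum⟩ := exists_hasSum_of_analyticAt hf
  obtain ⟨Θ, hΘ, hlin⟩ := exists_linear_cohomological_solution hR hb hsum
  have hav := hasSum_average hC hR hb hsum
  -- Under X = x², Y = y² the field x∂x − y∂y becomes 2(X∂X − Y∂Y), whence the factor 1/2 in the
  -- solution below.
  let sq : ℝ × ℝ → ℝ × ℝ := fun z => (z.1 ^ 2, z.2 ^ 2)
  have hsq : ∀ z : ℝ × ℝ, AnalyticAt ℝ sq z := fun z =>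
    (analyticAt_fst.pow 2).prod (analyticAt_snd.pow 2)
  have hsq0 : sq 0 = 0 := by simp [sq]
  have hcont : Tendsto sq (𝓝 0) (𝓝 0) := by
    simpa [hsq0] using (hsq 0).continuousAt.tendsto
  have hcont2 : Tendsto (fun z : ℝ × ℝ => z.1 * z.2) (𝓝 0) (𝓝 0) := by
    have : Continuous fun z : ℝ × ℝ => z.1 * z.2 := by fun_prop
    simpa using this.tendsto (0 : ℝ × ℝ)
  have hΘ' : AnalyticAt ℝ Θ (sq 0) := by rwa [hsq0]
  refine ⟨fun z => 1 / 2 * Θ (sq z), analyticAt_const.mul (hΘ'.comp (hsq 0)), ?_⟩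
  filter_upwards [hcont.eventually hlin, hcont.eventually hΘ.eventually_analyticAt,
    hcont2.eventually hav] with z h1 h2 h3
  have h4 : HasSum (fun n => b n * diagCoeff n * (z.1 * z.2) ^ n)
      (f ((sq z).1 + (sq z).2) - fderiv ℝ Θ (sq z) ((sq z).1, -(sq z).2)) := by
    convert! h1 using 2 with n
    by_cases hn : Even n
    · obtain ⟨m, rfl⟩ := hn
      have h2 : (m + m) / 2 = m := by omega
      simp only [sq, h2]
      ring
    · simp [diagCoeff, hn]
  have h5 := h4.unique h3
  have h6 : HasFDerivAt sq ((2 * z.1) • (ContinuousLinearMap.fst ℝ ℝ ℝ) |>.prod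
      ((2 * z.2) • (ContinuousLinearMap.snd ℝ ℝ ℝ))) z := by
    have e1 := (hasFDerivAt_fst (𝕜 := ℝ) (p := z)).pow 2
    have e2 := (hasFDerivAt_snd (𝕜 := ℝ) (p := z)).pow 2
    simpa using e1.prodMk e2
  have h7 := (h2.differentiableAt.hasFDerivAt.comp z h6).const_mul (1 / 2)
  have h8 : fderiv ℝ (fun z => 1 / 2 * Θ (sq z)) z = _ := h7.fderiv
  have h9 : ((2 * z.1 * z.1, 2 * z.2 * -z.2) : ℝ × ℝ) = (2 : ℝ) • ((sq z).1, -(sq z).2) := by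
    simp only [sq, Prod.smul_mk, smul_eq_mul]
    congr 1 <;> ring
  rw [h8, ← h5]
  simp only [smul_apply, ContinuousLinearMap.comp_apply, ContinuousLinearMap.prod_apply,
    smul_eq_mul]
  change 1 / 2 * fderiv ℝ Θ (sq z) (2 * z.1 * z.1, 2 * z.2 * -z.2) = _
  rw [h9, map_smul]
  simp [sq]

theorem analyticAt_average {f : ℝ → ℝ} (hf : AnalyticAt ℝ f 0) :
    AnalyticAt ℝ (fun s => 1 / Real.pi * ∫ θ in (0 : ℝ)..Real.pi, f (2 * s * Real.cos θ)) 0 := by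
  obtain ⟨b, C, R, hC, hR, hb, hsum⟩ := exists_hasSum_of_analyticAt hf
  refine ⟨FormalMultilinearSeries.ofScalars ℝ fun n => b n * diagCoeff n,
    hasFPowerSeriesAt_iff'.2 ?_⟩
  filter_upwards [hasSum_average hC hR hb hsum] with s hs
  simpa [FormalMultilinearSeries.coeff_ofScalars, mul_comm] using hs

/-! ### Trigonometric forms of the elliptic integral. -/

theorem analyticAt_sqrt {x : ℝ} (hx : 0 < x) : AnalyticAt ℝ Real.sqrt x := by
  have : (ContDiffAt ℝ ⊤ Real.sqrt x) := Real.contDiffAt_sqrt hx.ne'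
  exact this.analyticAt

theorem analyticAt_sqrt_comp {E : Type*} [NormedAddCommGroup E] [NormedSpace ℝ E] {f : E → ℝ}
    {x : E} (hf : AnalyticAt ℝ f x) (hx : 0 < f x) : AnalyticAt ℝ (fun z => √(f z)) x :=
  (analyticAt_sqrt hx).comp hf

/-- Substitution x = sin φ. Working on open intervals avoids the singularity at x = 1, and the
injective change of variables needs no integrability, so every real t is allowed. -/
theorem ellipticK_eq_integral_sin (t : ℝ) :
    ellipticK t = ∫ φ in (0 : ℝ)..(Real.pi / 2), 1 / √(1 - t * Real.sin φ ^ 2) := by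
  have hpi : (0 : ℝ) ≤ Real.pi / 2 := by positivity
  have himg : Real.sin '' Ioo 0 (Real.pi / 2) = Ioo 0 1 := by
    ext y
    constructor
    · rintro ⟨x, hx, rfl⟩
      refine ⟨Real.sin_pos_of_pos_of_lt_pi hx.1 (by linarith [hx.2, Real.pi_pos]), ?_⟩
      rw [← Real.sin_pi_div_two]
      exact Real.sin_lt_sin_of_lt_of_le_pi_div_two (by linarith [hx.1]) le_rfl hx.2
    · intro hy
      refine ⟨Real.arcsin y, ⟨Real.arcsin_pos.2 hy.1, Real.arcsin_lt_pi_div_two.2 hy.2⟩, ?_⟩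
      exact Real.sin_arcsin (by linarith [hy.1]) hy.2.le
  have hinj : InjOn Real.sin (Ioo 0 (Real.pi / 2)) :=
    Real.injOn_sin.mono (fun x (hx : x ∈ Ioo 0 (Real.pi / 2)) => mem_Icc.2 ⟨by linarith [hx.1], hx.2.le⟩)
  rw [ellipticK, intervalIntegral.integral_of_le zero_le_one,
    MeasureTheory.integral_Ioc_eq_integral_Ioo, ← himg,
    MeasureTheory.integral_image_eq_integral_abs_deriv_smul measurableSet_Ioo
      (fun x _ => (Real.hasDerivAt_sin x).hasDerivWithinAt) hinj,
    intervalIntegral.integral_of_le hpi, MeasureTheory.integral_Ioc_eq_integral_Ioo]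
  refine MeasureTheory.setIntegral_congr_fun measurableSet_Ioo fun x hx => ?_
  have hc : 0 < Real.cos x := Real.cos_pos_of_mem_Ioo ⟨by linarith [hx.1], hx.2⟩
  have h1 : 1 - Real.sin x ^ 2 = Real.cos x ^ 2 := by
    rw [← Real.sin_sq_add_cos_sq x]; ring
  simp only [smul_eq_mul]
  rw [h1, Real.sqrt_mul (sq_nonneg _), Real.sqrt_sq hc.le, abs_of_pos hc, mul_one_div,
    div_mul_cancel_left₀ hc.ne', one_div]

/-- The substitution θ = π − 2φ turns u − v cos θ into (u + v) − 2v sin² φ. -/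
theorem integral_one_div_sqrt_sub_cos (u v : ℝ) (huv : 0 < u + v) :
    ∫ θ in (0 : ℝ)..Real.pi, 1 / √(u - v * Real.cos θ) =
      2 / √(u + v) * ellipticK (2 * v / (u + v)) := by
  have h := intervalIntegral.integral_comp_sub_mul (a := 0) (b := Real.pi / 2)
    (fun θ => 1 / √(u - v * Real.cos θ)) (two_ne_zero : (2 : ℝ) ≠ 0) Real.pi
  rw [show Real.pi - 2 * (Real.pi / 2) = 0 by ring, mul_zero, sub_zero, smul_eq_mul] at h
  rw [ellipticK_eq_integral_sin, ← intervalIntegral.integral_const_mul,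
    ← mul_inv_cancel_left₀ (two_ne_zero : (2 : ℝ) ≠ 0)
      (∫ θ in (0 : ℝ)..Real.pi, 1 / √(u - v * Real.cos θ)), ← h,
    ← intervalIntegral.integral_const_mul]
  refine intervalIntegral.integral_congr fun φ _ => ?_
  have h1 : u - v * Real.cos (Real.pi - 2 * φ) =
      (u + v) * (1 - 2 * v / (u + v) * Real.sin φ ^ 2) := by
    rw [Real.cos_pi_sub, Real.cos_two_mul, Real.cos_sq']
    field_simp
    ring
  rw [h1, Real.sqrt_mul huv.le]
  ring

/-! ### The model density and its period. -/

/-- The density of the symplectic form in coordinates where the Hamiltonian is `x * y`. -/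
noncomputable def modelDensity (c m α β : ℝ) (z : ℝ × ℝ) : ℝ :=
  c / √(m - β * (z.1 * z.2) - α * (z.1 ^ 2 + z.2 ^ 2))

/-- The average of `modelDensity` over the vanishing cycle `x * y = s`. -/
noncomputable def modelPeriod (c m α β s : ℝ) : ℝ :=
  1 / Real.pi * ∫ θ in (0 : ℝ)..Real.pi, c / √(m - β * s - 2 * α * s * Real.cos θ)

theorem modelPeriod_eq (c m α β s : ℝ) (h : 0 < m - β * s + 2 * α * s) :
    modelPeriod c m α β s = 2 * c / (Real.pi * √(m - β * s + 2 * α * s)) *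
      ellipticK (4 * α * s / (m - β * s + 2 * α * s)) := by
  have h1 : ∀ θ : ℝ, c / √(m - β * s - 2 * α * s * Real.cos θ) =
      c * (1 / √((m - β * s) - (2 * α * s) * Real.cos θ)) := fun θ => by rw [mul_one_div]
  rw [modelPeriod, intervalIntegral.integral_congr fun θ _ => h1 θ,
    intervalIntegral.integral_const_mul, integral_one_div_sqrt_sub_cos _ _ h,
    show 2 * (2 * α * s) = 4 * α * s by ring]
  field_simp

theorem modelPeriod_zero (c m α β : ℝ) : modelPeriod c m α β 0 = c / √m := by
  simp only [modelPeriod, mul_zero, zero_mul, sub_zero, intervalIntegral.integral_const,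
    smul_eq_mul]
  field_simp

/-- Factoring out m − βs leaves the average of the one-variable function 1/√(1 − z) at a rescaled
point; the analyticity of the period and the decomposition of the density thus reduce to that
function. -/
theorem modelPeriod_eq_average {c m α β s : ℝ} (h : 0 < m - β * s) :
    modelPeriod c m α β s = c / √(m - β * s) * (1 / Real.pi * ∫ θ in (0 : ℝ)..Real.pi,
      1 / √(1 - 2 * (α / (m - β * s) * s) * Real.cos θ)) := by
  rw [modelPeriod, mul_left_comm (c / _),
    ← intervalIntegral.integral_const_mul (c / √(m - β * s))]
  congr 1
  refine intervalIntegral.integral_congr fun θ _ => ?_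
  have h1 : m - β * s - 2 * α * s * Real.cos θ =
      (m - β * s) * (1 - 2 * (α / (m - β * s) * s) * Real.cos θ) := by
    field_simp
  rw [h1, Real.sqrt_mul h.le, div_mul_div_comm, mul_one]

theorem analyticAt_one_div_sqrt_one_sub : AnalyticAt ℝ (fun z : ℝ => 1 / √(1 - z)) 0 := by
  have h1 : AnalyticAt ℝ (fun z : ℝ => 1 - z) 0 := analyticAt_const.sub analyticAt_id
  exact analyticAt_const.div (analyticAt_sqrt_comp h1 (by norm_num)) (by simp)

theorem analyticAt_modelPeriod {c m α β : ℝ} (hm : 0 < m) :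
    AnalyticAt ℝ (modelPeriod c m α β) 0 := by
  have hp := analyticAt_average analyticAt_one_div_sqrt_one_sub
  have h1 : AnalyticAt ℝ (fun s : ℝ => m - β * s) 0 :=
    analyticAt_const.sub (analyticAt_const.mul analyticAt_id)
  have h3 : AnalyticAt ℝ (fun s : ℝ => α / (m - β * s) * s) 0 :=
    (analyticAt_const.div h1 (by simpa using hm.ne')).mul analyticAt_id
  have h4 : AnalyticAt ℝ (fun s : ℝ => c / √(m - β * s)) 0 :=
    analyticAt_const.div (analyticAt_sqrt_comp h1 (by simpa))
      (by simpa using (Real.sqrt_pos.2 hm).ne')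
  have h5 := h4.mul (hp.comp_of_eq h3 (by simp))
  refine h5.congr ?_
  have hev : ∀ᶠ s in 𝓝 (0 : ℝ), 0 < m - β * s :=
    h1.continuousAt.eventually_const_lt (by simpa)
  filter_upwards [hev] with s hs
  exact (modelPeriod_eq_average hs).symm

/-- The density is the sum of its period and of a derivative along the hyperbolic vector field. -/
theorem exists_modelDensity_decomposition {c m α β : ℝ} (hm : 0 < m) (hα : 0 < α) :
    ∃ Ψ : ℝ × ℝ → ℝ, AnalyticAt ℝ Ψ 0 ∧ ∀ᶠ z in 𝓝 (0 : ℝ × ℝ),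
      modelDensity c m α β z =
        modelPeriod c m α β (z.1 * z.2) + fderiv ℝ Ψ z (z.1, -z.2) := by
  obtain ⟨Θ, hΘ, hΘeq⟩ := exists_cohomological_solution analyticAt_one_div_sqrt_one_sub
  -- The factors `κ` and `ρ` depend only on xy, so they are constant along the hyperbolic flow and
  -- the rescaling `T` commutes with it. The choice of `ρ` turns the radicand into (m − βxy)(1 − |T
  -- z|²), with the Euclidean norm.
  let κ : ℝ → ℝ := fun s => c / √(m - β * s)
  let ρ : ℝ → ℝ := fun s => √(α / (m - β * s))
  let T : ℝ × ℝ → ℝ × ℝ := fun z => (z.1 * ρ (z.1 * z.2), z.2 * ρ (z.1 * z.2))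
  have hs : AnalyticAt ℝ (fun z : ℝ × ℝ => z.1 * z.2) 0 := analyticAt_fst.mul analyticAt_snd
  have h1 : AnalyticAt ℝ (fun z : ℝ × ℝ => m - β * (z.1 * z.2)) 0 :=
    analyticAt_const.sub (analyticAt_const.mul hs)
  have hκ : AnalyticAt ℝ (fun z : ℝ × ℝ => κ (z.1 * z.2)) 0 := by
    exact analyticAt_const.div (analyticAt_sqrt_comp h1 (by simpa)) (by simpa using (Real.sqrt_pos.2 hm).ne')
  have hρ : AnalyticAt ℝ (fun z : ℝ × ℝ => ρ (z.1 * z.2)) 0 := by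
    have h3 : AnalyticAt ℝ (fun z : ℝ × ℝ => α / (m - β * (z.1 * z.2))) 0 :=
      analyticAt_const.div h1 (by simpa using hm.ne')
    exact analyticAt_sqrt_comp h3 (by simp; positivity)
  have hT : AnalyticAt ℝ T 0 := (analyticAt_fst.mul hρ).prod (analyticAt_snd.mul hρ)
  have hT0 : T 0 = 0 := by simp [T]
  have hΘT : AnalyticAt ℝ Θ (T 0) := by rwa [hT0]
  have hΨ : AnalyticAt ℝ (fun z : ℝ × ℝ => κ (z.1 * z.2) * Θ (T z)) 0 := hκ.mul (hΘT.comp hT)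
  refine ⟨_, hΨ, ?_⟩
  have hTt : Tendsto T (𝓝 0) (𝓝 0) := by simpa [hT0] using hT.continuousAt.tendsto
  have hev : ∀ᶠ z in 𝓝 (0 : ℝ × ℝ), 0 < m - β * (z.1 * z.2) :=
    h1.continuousAt.eventually_const_lt (by simpa)
  filter_upwards [hev, hTt.eventually hΘeq, hTt.eventually hΘ.eventually_analyticAt,
    hΨ.eventually_analyticAt] with z hz h4 h5 h6
  have h7 := hasDerivAt_comp_hyperbolic_flow h6.differentiableAt
  have h8 := (hasDerivAt_comp_hyperbolic_flow h5.differentiableAt).const_mul (κ (z.1 * z.2))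
  have h9 : (fun t : ℝ => (fun z : ℝ × ℝ => κ (z.1 * z.2) * Θ (T z))
      (z.1 * Real.exp t, z.2 * Real.exp (-t))) = fun t =>
      κ (z.1 * z.2) * Θ ((T z).1 * Real.exp t, (T z).2 * Real.exp (-t)) := by
    funext t
    have : z.1 * Real.exp t * (z.2 * Real.exp (-t)) = z.1 * z.2 := by
      rw [mul_mul_mul_comm, ← Real.exp_add]; simp
    simp only [T, this]
    rw [mul_right_comm, mul_right_comm z.2]
  rw [h9] at h7
  rw [h7.unique h8, h4, modelPeriod_eq_average hz]
  have hρ2 : ρ (z.1 * z.2) ^ 2 = α / (m - β * (z.1 * z.2)) := Real.sq_sqrt (by positivity)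
  have e1 : (T z).1 * (T z).2 = α / (m - β * (z.1 * z.2)) * (z.1 * z.2) := by
    rw [← hρ2]; simp only [T]; ring
  have e2 : m - β * (z.1 * z.2) - α * (z.1 ^ 2 + z.2 ^ 2) =
      (m - β * (z.1 * z.2)) * (1 - ((T z).1 ^ 2 + (T z).2 ^ 2)) := by
    have : (T z).1 ^ 2 + (T z).2 ^ 2 = ρ (z.1 * z.2) ^ 2 * (z.1 ^ 2 + z.2 ^ 2) := by
      simp only [T]; ring
    rw [this, hρ2]
    generalize m - β * (z.1 * z.2) = M at hz ⊢
    field_simp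
  rw [modelDensity, e1, e2, Real.sqrt_mul hz.le, ← mul_add, add_sub_cancel]
  rw [div_mul_div_comm, mul_one]

/-! ### Rigidity: the period determines the normal form. -/

theorem analyticAt_log_comp {E : Type*} [NormedAddCommGroup E] [NormedSpace ℝ E] {f : E → ℝ}
    {x : E} (hf : AnalyticAt ℝ f x) (hx : f x ≠ 0) : AnalyticAt ℝ (fun z => Real.log (f z)) x := by
  have h : ContDiffAt ℝ ⊤ Real.log (f x) := Real.contDiffAt_log.2 hx
  exact h.analyticAt.comp hf

/-- The logarithm is not a quotient of analytic functions at `0`. -/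
theorem eventually_eq_zero_of_mul_log {F G : ℝ → ℝ} (hF : AnalyticAt ℝ F 0)
    (hG : AnalyticAt ℝ G 0) (h : ∀ᶠ s in 𝓝[>] (0 : ℝ), F s * Real.log s = G s) :
    ∀ᶠ s in 𝓝 (0 : ℝ), F s = 0 := by
  have hlt1 : ∀ᶠ s in 𝓝[>] (0 : ℝ), s ∈ Ioo (0 : ℝ) 1 := Ioo_mem_nhdsGT one_pos
  by_contra hF0
  obtain ⟨n, F₁, hF₁, hF₁0, hFeq⟩ := hF.exists_eventuallyEq_pow_smul_nonzero_iff.2 hF0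
  have hFeq' := hFeq.filter_mono (nhdsWithin_le_nhds (s := Ioi (0 : ℝ)))
  have hF₁t : Tendsto F₁ (𝓝[>] 0) (𝓝 (F₁ 0)) := hF₁.continuousAt.mono_left nhdsWithin_le_nhds
  have hF₁ne : ∀ᶠ s in 𝓝[>] (0 : ℝ), F₁ s ≠ 0 := hF₁t.eventually_ne hF₁0
  have hlog := Real.tendsto_log_nhdsGT_zero
  by_cases hG0 : ∀ᶠ s in 𝓝 (0 : ℝ), G s = 0
  · obtain ⟨s, h1, h2, h3, h4, h5⟩ := (h.and (hFeq'.and (hF₁ne.and (hlt1.and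
      (hG0.filter_mono nhdsWithin_le_nhds))))).exists
    rw [h5, h2, smul_eq_mul, sub_zero] at h1
    exact mul_ne_zero (mul_ne_zero (pow_ne_zero _ h4.1.ne') h3) (Real.log_neg h4.1 h4.2).ne h1
  obtain ⟨m, G₁, hG₁, hG₁0, hGeq⟩ := hG.exists_eventuallyEq_pow_smul_nonzero_iff.2 hG0
  have hGeq' := hGeq.filter_mono (nhdsWithin_le_nhds (s := Ioi (0 : ℝ)))
  have hG₁t : Tendsto G₁ (𝓝[>] 0) (𝓝 (G₁ 0)) := hG₁.continuousAt.mono_left nhdsWithin_le_nhds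
  have hpow : ∀ k : ℕ, Tendsto (fun s : ℝ => s ^ k) (𝓝[>] 0) (𝓝 ((0 : ℝ) ^ k)) := fun k =>
    (continuous_pow k).continuousAt.mono_left nhdsWithin_le_nhds
  -- Here n and m are the orders of vanishing of F and G. If n ≤ m, the logarithm would have a
  -- finite limit at 0; if n > m, the limit s^(n−m) log s → 0 would force G₁(0) = 0.
  rcases le_or_gt n m with hnm | hmn
  · have h1 : Tendsto (fun s => s ^ (m - n) * G₁ s / F₁ s) (𝓝[>] 0)
        (𝓝 ((0 : ℝ) ^ (m - n) * G₁ 0 / F₁ 0)) := ((hpow _).mul hG₁t).div hF₁t hF₁0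
    refine not_tendsto_nhds_of_tendsto_atBot hlog _ (h1.congr' ?_)
    filter_upwards [h, hFeq', hGeq', hF₁ne, hlt1] with s h2 h3 h4 h5 h6
    rw [h3, h4, smul_eq_mul, smul_eq_mul, sub_zero, ← Nat.sub_add_cancel hnm, pow_add] at h2
    have h7 := pow_ne_zero n h6.1.ne'
    rw [div_eq_iff h5]
    apply mul_left_cancel₀ h7
    linear_combination -h2
  · have h1 : Tendsto (fun s : ℝ => s ^ (n - m) * Real.log s) (𝓝[>] 0) (𝓝 0) := by
      have := tendsto_log_mul_rpow_nhdsGT_zero (r := ((n - m : ℕ) : ℝ))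
        (by exact_mod_cast Nat.sub_pos_of_lt hmn)
      refine this.congr fun s => ?_
      rw [Real.rpow_natCast, mul_comm]
    have h2 : Tendsto (fun s => s ^ (n - m) * Real.log s * F₁ s) (𝓝[>] 0) (𝓝 (0 * F₁ 0)) :=
      h1.mul hF₁t
    rw [zero_mul] at h2
    refine hG₁0 (tendsto_nhds_unique hG₁t (h2.congr' ?_))
    filter_upwards [h, hFeq', hGeq', hlt1] with s h2 h3 h4 h6
    rw [h3, h4, smul_eq_mul, smul_eq_mul, sub_zero, ← Nat.sub_add_cancel hmn.le, pow_add] at h2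
    have h7 := pow_ne_zero m h6.1.ne'
    apply mul_left_cancel₀ h7
    linear_combination h2

theorem analyticAt_dslope {f : ℝ → ℝ} {x : ℝ} (hf : AnalyticAt ℝ f x) :
    AnalyticAt ℝ (dslope f x) x := by
  obtain ⟨p, hp⟩ := hf
  exact ⟨_, hp.has_fpower_series_dslope_fslope⟩

theorem apply_eq_fst_mul_add_snd_mul (A : ℝ × ℝ →L[ℝ] ℝ) (w : ℝ × ℝ) :
    A w = w.1 * A (1, 0) + w.2 * A (0, 1) := by
  rw [← smul_eq_mul, ← smul_eq_mul, ← map_smul, ← map_smul, ← map_add]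
  simp

/-- The conclusion of `deriv_mul_period_eq`, for fixed `s`, after integrating along the
hyperbola `X * Y = s`. -/
theorem deriv_mul_sub_eq_of_flow {Ψ ξ η : ℝ × ℝ → ℝ} {E : ℝ → ℝ} {σ p δ s : ℝ} (hδ : 0 < δ)
    (hs : 0 < s) (hsδ : s < δ ^ 2) (hE0 : E s ≠ 0)
    (hgood : ∀ z : ℝ × ℝ, |z.1| ≤ δ → |z.2| ≤ δ → z.1 * z.2 = s →
      DifferentiableAt ℝ ξ z ∧ DifferentiableAt ℝ η z ∧ DifferentiableAt ℝ Ψ (ξ z, η z) ∧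
      DifferentiableAt ℝ E (z.1 * z.2) ∧
      (∀ᶠ w in 𝓝 z, ξ w * η w = E (w.1 * w.2)) ∧
      (fderiv ℝ ξ z (1, 0) * fderiv ℝ η z (0, 1) - fderiv ℝ ξ z (0, 1) * fderiv ℝ η z (1, 0)) *
        (p + fderiv ℝ Ψ (ξ z, η z) (ξ z, -η z)) = σ) :
    deriv E s * (p * (Real.log (ξ (δ, s / δ)) + Real.log (η (s / δ, δ)) - Real.log (E s)) +
      (Ψ (ξ (δ, s / δ), η (δ, s / δ)) - Ψ (ξ (s / δ, δ), η (s / δ, δ)))) =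
      σ * (2 * Real.log δ - Real.log s) := by
  -- An orbit of X∂X − Y∂Y on the hyperbola XY = s; `T` is the time it takes to cross the box of
  -- size δ.
  let γ : ℝ → ℝ × ℝ := fun t => (s / δ * Real.exp t, δ * Real.exp (-t))
  let T : ℝ := 2 * Real.log δ - Real.log s
  have hsδ' : 0 < s / δ := by positivity
  have hT : 0 < T := by
    have := Real.log_lt_log hs hsδ
    rw [Real.log_pow] at this
    simp only [T]
    push_cast at this
    linarith
  have hexpT : Real.exp T = δ ^ 2 / s := by
    simp only [T]
    rw [Real.exp_sub, Real.exp_log hs, show 2 * Real.log δ = Real.log (δ ^ 2) by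
      rw [Real.log_pow]; norm_num, Real.exp_log (by positivity)]
  have hγs : ∀ t, (γ t).1 * (γ t).2 = s := fun t => by
    simp only [γ]
    rw [mul_mul_mul_comm, ← Real.exp_add]
    simp only [add_neg_cancel, Real.exp_zero]
    field_simp
  have hγ0 : γ 0 = (s / δ, δ) := by simp [γ]
  have hγT : γ T = (δ, s / δ) := by
    simp only [γ]
    rw [Real.exp_neg, hexpT]
    congr 1 <;> field_simp
  -- A clock for the orbit: (x∂x − y∂y) applied to (p/2)(log x − log y) + Ψ gives p + (x∂x − y∂y)Ψ,
  -- the density on this level set. Hence E'(s) W grows at the constant rate σ.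
  let W : ℝ → ℝ := fun t => p / 2 * (Real.log (ξ (γ t)) - Real.log (η (γ t))) +
    Ψ (ξ (γ t), η (γ t))
  have hW : ∀ t ∈ Icc 0 T, HasDerivAt (fun t => deriv E s * W t - σ * t) 0 t := by
    intro t ht
    have hg1 : |(γ t).1| ≤ δ := by
      simp only [γ]
      rw [abs_of_pos (by positivity)]
      calc s / δ * Real.exp t ≤ s / δ * Real.exp T := by gcongr; exact ht.2
        _ = δ := by rw [hexpT]; field_simp
    have hg2 : |(γ t).2| ≤ δ := by
      simp only [γ]
      rw [abs_of_pos (by positivity)]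
      exact mul_le_of_le_one_right hδ.le (Real.exp_le_one_iff.2 (by linarith [ht.1]))
    obtain ⟨h1, h2, h3, h4, h5, h6⟩ := hgood (γ t) hg1 hg2 (hγs t)
    set z := γ t with hz
    set ξ₁ := fderiv ℝ ξ z (1, 0)
    set ξ₂ := fderiv ℝ ξ z (0, 1)
    set η₁ := fderiv ℝ η z (1, 0)
    set η₂ := fderiv ℝ η z (0, 1)
    have hγ' : HasDerivAt γ (z.1, -z.2) t := by
      have e1 := (Real.hasDerivAt_exp t).const_mul (s / δ)
      have e2 := ((hasDerivAt_neg t).exp).const_mul δ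
      simpa [hz, γ] using e1.prodMk e2
    have hprod : ξ z * η z = E s := by rw [← hγs t]; exact h5.self_of_nhds
    have hξ0 : ξ z ≠ 0 := fun h => hE0 (by rw [← hprod, h, zero_mul])
    have hη0 : η z ≠ 0 := fun h => hE0 (by rw [← hprod, h, mul_zero])
    have hξt : HasDerivAt (fun t => ξ (γ t)) (z.1 * ξ₁ - z.2 * ξ₂) t := by
      have := h1.hasFDerivAt.comp_hasDerivAt t hγ'
      rw [apply_eq_fst_mul_add_snd_mul] at this
      exact this.congr_deriv (by ring)
    have hηt : HasDerivAt (fun t => η (γ t)) (z.1 * η₁ - z.2 * η₂) t := by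
      have := h2.hasFDerivAt.comp_hasDerivAt t hγ'
      rw [apply_eq_fst_mul_add_snd_mul] at this
      exact this.congr_deriv (by ring)
    -- derivatives of the identity `ξ * η = E (X * Y)`
    have hA : HasFDerivAt (fun w : ℝ × ℝ => ξ w * η w)
        (ξ z • fderiv ℝ η z + η z • fderiv ℝ ξ z) z := h1.hasFDerivAt.mul h2.hasFDerivAt
    have hB : HasFDerivAt (fun w : ℝ × ℝ => E (w.1 * w.2))
        (deriv E (z.1 * z.2) • (z.1 • ContinuousLinearMap.snd ℝ ℝ ℝ +
          z.2 • ContinuousLinearMap.fst ℝ ℝ ℝ)) z :=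
      h4.hasDerivAt.comp_hasFDerivAt z (hasFDerivAt_fst.mul hasFDerivAt_snd)
    have hAB := hA.unique (hB.congr_of_eventuallyEq h5)
    have hX : ξ z * η₁ + η z * ξ₁ = deriv E s * z.2 := by
      have := DFunLike.congr_fun hAB (1, 0)
      rw [hγs t] at this
      simpa using this
    have hY : ξ z * η₂ + η z * ξ₂ = deriv E s * z.1 := by
      have := DFunLike.congr_fun hAB (0, 1)
      rw [hγs t] at this
      simpa using this
    -- Cramer's rule: E' times the image of X∂X − Y∂Y is the Jacobian times x∂x − y∂y.
    have hJξ : deriv E s * (z.1 * ξ₁ - z.2 * ξ₂) = (ξ₁ * η₂ - ξ₂ * η₁) * ξ z := by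
      linear_combination ξ₂ * hX - ξ₁ * hY
    have hJη : deriv E s * (z.1 * η₁ - z.2 * η₂) = -((ξ₁ * η₂ - ξ₂ * η₁) * η z) := by
      linear_combination η₂ * hX - η₁ * hY
    have hΨt := h3.hasFDerivAt.comp_hasDerivAt t (hξt.prodMk hηt)
    have hWt := ((((hξt.log hξ0).sub (hηt.log hη0)).const_mul (p / 2)).add hΨt).const_mul
      (deriv E s)
    have hfin := hWt.sub ((hasDerivAt_id t).const_mul σ)
    refine hfin.congr_deriv ?_
    rw [apply_eq_fst_mul_add_snd_mul] at h6 ⊢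
    simp only at h6 ⊢
    have e1 : deriv E s * ((z.1 * ξ₁ - z.2 * ξ₂) / ξ z) = ξ₁ * η₂ - ξ₂ * η₁ := by
      rw [← mul_div_assoc, hJξ, mul_div_cancel_right₀ _ hξ0]
    have e2 : deriv E s * ((z.1 * η₁ - z.2 * η₂) / η z) = -(ξ₁ * η₂ - ξ₂ * η₁) := by
      rw [← mul_div_assoc, hJη, neg_div, mul_div_cancel_right₀ _ hη0]
    linear_combination p / 2 * e1 - p / 2 * e2 + fderiv ℝ Ψ (ξ z, η z) (1, 0) * hJξ +
      fderiv ℝ Ψ (ξ z, η z) (0, 1) * hJη + h6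
  have hconst : deriv E s * W T - σ * T = deriv E s * W 0 - σ * 0 := by
    refine constant_of_has_deriv_right_zero (a := 0) (b := T)
      (f := fun t => deriv E s * W t - σ * t)
      (fun t ht => (hW t ht).continuousAt.continuousWithinAt)
      (fun t ht => (hW t (Ico_subset_Icc_self ht)).hasDerivWithinAt) T ⟨hT.le, le_rfl⟩
  -- `Real.log` is the logarithm of the absolute value, so only nonvanishing matters and the signs
  -- of ξ, η and E(s) play no role.
  have hprod : ∀ z : ℝ × ℝ, |z.1| ≤ δ → |z.2| ≤ δ → z.1 * z.2 = s →
      Real.log (ξ z) + Real.log (η z) = Real.log (E s) := by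
    intro z h1 h2 h3
    have h4 := (hgood z h1 h2 h3).2.2.2.2.1.self_of_nhds
    rw [h3] at h4
    rw [← h4, Real.log_mul]
    · exact fun h => hE0 (by rw [← h4, h, zero_mul])
    · exact fun h => hE0 (by rw [← h4, h, mul_zero])
  have hle : |s / δ| ≤ δ := by
    rw [abs_of_pos hsδ', div_le_iff₀ hδ]
    nlinarith
  have hδa : |δ| ≤ δ := (abs_of_pos hδ).le
  have p1 := hprod (δ, s / δ) hδa hle (by field_simp)
  have p2 := hprod (s / δ, δ) hle hδa (by field_simp)
  simp only [W, hγ0, hγT] at hconst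
  simp only [T] at hconst
  linear_combination hconst + deriv E s * p / 2 * p1 + deriv E s * p / 2 * p2

/-- In any coordinates `(X, Y)` in which the density becomes constant and `x * y` becomes
`E (X * Y)`, the derivative of `E` is the inverse of the period, up to that constant. -/
theorem deriv_mul_period_eq {g Ψ ξ η : ℝ × ℝ → ℝ} {P E : ℝ → ℝ} {σ : ℝ} (hP : AnalyticAt ℝ P 0)
    (hΨ : AnalyticAt ℝ Ψ 0)
    (hg : ∀ᶠ z in 𝓝 (0 : ℝ × ℝ), g z = P (z.1 * z.2) + fderiv ℝ Ψ z (z.1, -z.2))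
    (hξ : AnalyticAt ℝ ξ 0) (hη : AnalyticAt ℝ η 0) (hξ0 : ξ 0 = 0) (hη0 : η 0 = 0)
    (hE : AnalyticAt ℝ E 0)
    (hprod : ∀ᶠ z in 𝓝 (0 : ℝ × ℝ), ξ z * η z = E (z.1 * z.2))
    (hJ : ∀ᶠ z in 𝓝 (0 : ℝ × ℝ), (fderiv ℝ ξ z (1, 0) * fderiv ℝ η z (0, 1) -
      fderiv ℝ ξ z (0, 1) * fderiv ℝ η z (1, 0)) * g (ξ z, η z) = σ)
    (hξ1 : fderiv ℝ ξ 0 (1, 0) ≠ 0) (hη1 : fderiv ℝ η 0 (0, 1) ≠ 0) (hE1 : deriv E 0 ≠ 0) :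
    ∀ᶠ s in 𝓝 (0 : ℝ), deriv E s * P (E s) = σ := by
  have hχt : Tendsto (fun z => (ξ z, η z)) (𝓝 (0 : ℝ × ℝ)) (𝓝 0) := by
    have := hξ.continuousAt.tendsto.prodMk_nhds hη.continuousAt.tendsto
    rwa [hξ0, hη0] at this
  have hmt : Tendsto (fun z : ℝ × ℝ => z.1 * z.2) (𝓝 0) (𝓝 0) := by
    have : Continuous fun z : ℝ × ℝ => z.1 * z.2 := by fun_prop
    simpa using this.tendsto (0 : ℝ × ℝ)
  have hE0 : E 0 = 0 := by
    have := hprod.self_of_nhds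
    simpa [hξ0] using this.symm
  obtain ⟨r, hr, hgood⟩ := Metric.eventually_nhds_iff.1 (hξ.eventually_analyticAt.and
    (hη.eventually_analyticAt.and ((hχt.eventually hΨ.eventually_analyticAt).and
    ((hmt.eventually hE.eventually_analyticAt).and (hprod.eventually_nhds.and
    (hJ.and (hχt.eventually hg)))))))
  -- The size δ is chosen with ξ(δ, 0) and η(0, δ) nonzero; the logarithms at the two ends of the
  -- orbit are then analytic in s at 0.
  have hne1 : ∀ᶠ t in 𝓝[>] (0 : ℝ), ξ (t, 0) ≠ 0 := by
    have h1 : HasDerivAt (fun t : ℝ => ((t, 0) : ℝ × ℝ)) (1, 0) 0 :=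
      (hasDerivAt_id _).prodMk (hasDerivAt_const _ _)
    have h2 : HasFDerivAt ξ (fderiv ℝ ξ 0) ((0 : ℝ), (0 : ℝ)) := hξ.differentiableAt.hasFDerivAt
    have h3 : HasDerivAt (fun t : ℝ => ξ (t, 0)) (fderiv ℝ ξ 0 (1, 0)) 0 :=
      HasFDerivAt.comp_hasDerivAt (f := fun t : ℝ => ((t, 0) : ℝ × ℝ)) 0 h2 h1
    have := h3.eventually_ne (c := 0) hξ1
    exact this.filter_mono (nhdsGT_le_nhdsNE 0)
  have hne2 : ∀ᶠ t in 𝓝[>] (0 : ℝ), η (0, t) ≠ 0 := by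
    have h1 : HasDerivAt (fun t : ℝ => ((0, t) : ℝ × ℝ)) (0, 1) 0 :=
      (hasDerivAt_const _ _).prodMk (hasDerivAt_id _)
    have h2 : HasFDerivAt η (fderiv ℝ η 0) ((0 : ℝ), (0 : ℝ)) := hη.differentiableAt.hasFDerivAt
    have := (h2.comp_hasDerivAt (0 : ℝ) h1).eventually_ne (c := 0) hη1
    exact this.filter_mono (nhdsGT_le_nhdsNE 0)
  have hio : ∀ᶠ t in 𝓝[>] (0 : ℝ), t ∈ Ioo 0 r := Ioo_mem_nhdsGT hr
  obtain ⟨δ, hξδ, hηδ, hδ, hδr⟩ := (hne1.and (hne2.and hio)).exists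
  have hbox : ∀ z : ℝ × ℝ, |z.1| ≤ δ → |z.2| ≤ δ → dist z 0 < r := by
    intro z h1 h2
    rw [dist_zero_right, Prod.norm_def]
    exact (max_le h1 h2).trans_lt hδr
  have hδa : |δ| ≤ δ := (abs_of_pos hδ).le
  obtain ⟨hξa, hηa, hΨa, -, -, -⟩ := hgood (hbox (δ, 0) hδa (by simpa using hδ.le))
  obtain ⟨hξb, hηb, hΨb, -, -, -⟩ := hgood (hbox (0, δ) (by simpa using hδ.le) hδa)
  -- endpoint curves
  have hca : AnalyticAt ℝ (fun s : ℝ => ((δ, s / δ) : ℝ × ℝ)) 0 :=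
    analyticAt_const.prod (analyticAt_id.div_const)
  have hcb : AnalyticAt ℝ (fun s : ℝ => ((s / δ, δ) : ℝ × ℝ)) 0 :=
    (analyticAt_id.div_const).prod analyticAt_const
  have kξa : AnalyticAt ℝ (fun s : ℝ => ξ (δ, s / δ)) 0 := hξa.comp_of_eq hca (by simp)
  have kηa : AnalyticAt ℝ (fun s : ℝ => η (δ, s / δ)) 0 := hηa.comp_of_eq hca (by simp)
  have kξb : AnalyticAt ℝ (fun s : ℝ => ξ (s / δ, δ)) 0 := hξb.comp_of_eq hcb (by simp)
  have kηb : AnalyticAt ℝ (fun s : ℝ => η (s / δ, δ)) 0 := hηb.comp_of_eq hcb (by simp)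
  have kΨa : AnalyticAt ℝ (fun s : ℝ => Ψ (ξ (δ, s / δ), η (δ, s / δ))) 0 :=
    hΨa.comp_of_eq (kξa.prod kηa) (by simp)
  have kΨb : AnalyticAt ℝ (fun s : ℝ => Ψ (ξ (s / δ, δ), η (s / δ, δ))) 0 :=
    hΨb.comp_of_eq (kξb.prod kηb) (by simp)
  have kla : AnalyticAt ℝ (fun s : ℝ => Real.log (ξ (δ, s / δ))) 0 :=
    analyticAt_log_comp kξa (by simpa using hξδ)
  have klb : AnalyticAt ℝ (fun s : ℝ => Real.log (η (s / δ, δ))) 0 :=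
    analyticAt_log_comp kηb (by simpa using hηδ)
  -- This slope is E(s)/s, nonvanishing at 0. So log E(s) is log s plus an analytic function, and
  -- log s is the only singular term left.
  have he := analyticAt_dslope hE
  have he0 : dslope E 0 0 ≠ 0 := by rwa [dslope_same]
  have hle : AnalyticAt ℝ (fun s : ℝ => Real.log (dslope E 0 s)) 0 := analyticAt_log_comp he he0
  have hPE : AnalyticAt ℝ (fun s => P (E s)) 0 := hP.comp_of_eq hE hE0
  have hG : AnalyticAt ℝ (fun s : ℝ => deriv E s * (P (E s) * (Real.log (ξ (δ, s / δ)) +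
      Real.log (η (s / δ, δ)) - Real.log (dslope E 0 s)) +
      (Ψ (ξ (δ, s / δ), η (δ, s / δ)) - Ψ (ξ (s / δ, δ), η (s / δ, δ)))) -
      σ * (2 * Real.log δ)) 0 :=
    (hE.deriv.mul ((hPE.mul ((kla.add klb).sub hle)).add (kΨa.sub kΨb))).sub analyticAt_const
  have hF : AnalyticAt ℝ (fun s => deriv E s * P (E s) - σ) 0 :=
    (hE.deriv.mul hPE).sub analyticAt_const
  have hio2 : ∀ᶠ s in 𝓝[>] (0 : ℝ), s ∈ Ioo 0 (δ ^ 2) := Ioo_mem_nhdsGT (by positivity)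
  have hene : ∀ᶠ s in 𝓝[>] (0 : ℝ), dslope E 0 s ≠ 0 :=
    (he.continuousAt.eventually_ne he0).filter_mono nhdsWithin_le_nhds
  have key := eventually_eq_zero_of_mul_log hF hG (by
    filter_upwards [hio2, hene] with s hs hes
    have hEs : E s = s * dslope E 0 s := by
      rw [dslope_of_ne _ hs.1.ne', slope_def_field, hE0, sub_zero, sub_zero,
        mul_div_cancel₀ _ hs.1.ne']
    have hEs0 : E s ≠ 0 := by rw [hEs]; exact mul_ne_zero hs.1.ne' hes
    have hflow := deriv_mul_sub_eq_of_flow (Ψ := Ψ) (ξ := ξ) (η := η) (σ := σ) (p := P (E s))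
      hδ hs.1 hs.2 hEs0 (by
        intro z h1 h2 h3
        obtain ⟨g1, g2, g3, g4, g5, g6, g7⟩ := hgood (hbox z h1 h2)
        refine ⟨g1.differentiableAt, g2.differentiableAt, g3.differentiableAt,
          g4.differentiableAt, g5, ?_⟩
        rw [← g6, g7, g5.self_of_nhds, h3])
    have hlogE : Real.log (E s) = Real.log s + Real.log (dslope E 0 s) := by
      rw [hEs, Real.log_mul hs.1.ne' hes]
    rw [hlogE] at hflow
    linear_combination -hflow)
  filter_upwards [key] with s hs
  linarith

/-- Nondegeneracy at the origin. -/
theorem deriv_ne_zero_of_mul_eq {ξ η : ℝ × ℝ → ℝ} {E : ℝ → ℝ}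
    (hξ : DifferentiableAt ℝ ξ 0) (hη : DifferentiableAt ℝ η 0) (hξ0 : ξ 0 = 0) (hη0 : η 0 = 0)
    (hE : DifferentiableAt ℝ E 0)
    (hprod : ∀ᶠ z in 𝓝 (0 : ℝ × ℝ), ξ z * η z = E (z.1 * z.2))
    (hJ : fderiv ℝ ξ 0 (1, 0) * fderiv ℝ η 0 (0, 1) -
      fderiv ℝ ξ 0 (0, 1) * fderiv ℝ η 0 (1, 0) ≠ 0) :
    deriv E 0 ≠ 0 ∧ ((fderiv ℝ ξ 0 (1, 0) ≠ 0 ∧ fderiv ℝ η 0 (0, 1) ≠ 0) ∨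
      (fderiv ℝ ξ 0 (0, 1) ≠ 0 ∧ fderiv ℝ η 0 (1, 0) ≠ 0)) := by
  have hE0 : E 0 = 0 := by
    have := hprod.self_of_nhds
    simpa [hξ0] using this.symm
  -- Comparing terms of order t² in ξη = E(XY) along (tu, tv). Since dξ · dη is then a multiple of
  -- uv, each factor must be proportional to one of the two coordinates.
  have hquad : ∀ u v : ℝ, fderiv ℝ ξ 0 (u, v) * fderiv ℝ η 0 (u, v) = deriv E 0 * (u * v) := by
    intro u v
    have hlin : HasDerivAt (fun t : ℝ => ((t * u, t * v) : ℝ × ℝ)) (u, v) 0 := by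
      simpa using ((hasDerivAt_id (0 : ℝ)).mul_const u).prodMk ((hasDerivAt_id (0 : ℝ)).mul_const v)
    have h0 : ((0 : ℝ) * u, (0 : ℝ) * v) = (0 : ℝ × ℝ) := by simp
    have dξ : HasDerivAt (fun t : ℝ => ξ (t * u, t * v)) (fderiv ℝ ξ 0 (u, v)) 0 := by
      have : HasFDerivAt ξ (fderiv ℝ ξ 0) ((0 : ℝ) * u, (0 : ℝ) * v) := by
        rw [h0]; exact hξ.hasFDerivAt
      exact this.comp_hasDerivAt (0 : ℝ) hlin
    have dη : HasDerivAt (fun t : ℝ => η (t * u, t * v)) (fderiv ℝ η 0 (u, v)) 0 := by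
      have : HasFDerivAt η (fderiv ℝ η 0) ((0 : ℝ) * u, (0 : ℝ) * v) := by
        rw [h0]; exact hη.hasFDerivAt
      exact this.comp_hasDerivAt (0 : ℝ) hlin
    have s1 := dξ.tendsto_slope_zero
    have s2 := dη.tendsto_slope_zero
    simp only [zero_add, zero_mul, Prod.mk_zero_zero, hξ0, hη0, sub_zero, smul_eq_mul] at s1 s2
    have s3 := s1.mul s2
    have hsq : Tendsto (fun t : ℝ => ((t * u, t * v) : ℝ × ℝ)) (𝓝[≠] 0) (𝓝 0) := by
      have := hlin.continuousAt.tendsto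
      rw [h0] at this
      exact this.mono_left nhdsWithin_le_nhds
    have dE : Tendsto (fun t : ℝ => dslope E 0 (t * u * (t * v)) * (u * v)) (𝓝[≠] 0)
        (𝓝 (deriv E 0 * (u * v))) := by
      have hc : ContinuousAt (dslope E 0) 0 := continuousAt_dslope_same.2 hE
      have hm : Tendsto (fun t : ℝ => t * u * (t * v)) (𝓝[≠] 0) (𝓝 0) := by
        have : Continuous fun t : ℝ => t * u * (t * v) := by fun_prop
        have := this.tendsto (0 : ℝ)
        simp only [zero_mul] at this
        exact this.mono_left nhdsWithin_le_nhds
      have := hc.tendsto.comp hm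
      rw [dslope_same] at this
      exact this.mul_const _
    refine tendsto_nhds_unique (s3.congr' ?_) dE
    filter_upwards [hsq.eventually hprod, self_mem_nhdsWithin] with t ht ht0
    have ht0 : t ≠ 0 := ht0
    have hEd : E (t * u * (t * v)) = t * u * (t * v) * dslope E 0 (t * u * (t * v)) := by
      have := sub_smul_dslope E 0 (t * u * (t * v))
      rw [sub_zero, hE0, sub_zero, smul_eq_mul] at this
      exact this.symm
    rw [hEd] at ht
    rw [mul_mul_mul_comm, ht]
    field_simp
  have hadd : ∀ A : ℝ × ℝ →L[ℝ] ℝ, A (1, 1) = A (1, 0) + A (0, 1) := fun A => by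
    simpa using apply_eq_fst_mul_add_snd_mul A (1, 1)
  have q10 := hquad 1 0
  have q01 := hquad 0 1
  have q11 := hquad 1 1
  rw [hadd, hadd] at q11
  simp only [mul_zero, mul_one] at q10 q01 q11
  rcases mul_eq_zero.1 q10 with h | h
  · rw [h, zero_mul, zero_sub, neg_ne_zero] at hJ
    obtain ⟨h1, h2⟩ := mul_ne_zero_iff.1 hJ
    refine ⟨?_, Or.inr ⟨h1, h2⟩⟩
    rw [← q11, h, (mul_eq_zero.1 q01).resolve_left h1]
    simpa using ⟨h1, h2⟩
  · rw [h, mul_zero, sub_zero] at hJ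
    obtain ⟨h1, h2⟩ := mul_ne_zero_iff.1 hJ
    refine ⟨?_, Or.inl ⟨h1, h2⟩⟩
    rw [← q11, h, (mul_eq_zero.1 q01).resolve_right h2]
    simpa using ⟨h1, h2⟩

/-- The two cases of `deriv_mul_period_eq` together. -/
theorem deriv_mul_period_eq_or_neg {g Ψ ξ η : ℝ × ℝ → ℝ} {P E : ℝ → ℝ} {σ : ℝ}
    (hP : AnalyticAt ℝ P 0) (hΨ : AnalyticAt ℝ Ψ 0)
    (hg : ∀ᶠ z in 𝓝 (0 : ℝ × ℝ), g z = P (z.1 * z.2) + fderiv ℝ Ψ z (z.1, -z.2))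
    (hξ : AnalyticAt ℝ ξ 0) (hη : AnalyticAt ℝ η 0) (hξ0 : ξ 0 = 0) (hη0 : η 0 = 0)
    (hE : AnalyticAt ℝ E 0)
    (hprod : ∀ᶠ z in 𝓝 (0 : ℝ × ℝ), ξ z * η z = E (z.1 * z.2)) (hσ : σ ≠ 0)
    (hJ : ∀ᶠ z in 𝓝 (0 : ℝ × ℝ), (fderiv ℝ ξ z (1, 0) * fderiv ℝ η z (0, 1) -
      fderiv ℝ ξ z (0, 1) * fderiv ℝ η z (1, 0)) * g (ξ z, η z) = σ) :
    deriv E 0 ≠ 0 ∧ ((∀ᶠ s in 𝓝 (0 : ℝ), deriv E s * P (E s) = σ) ∨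
      (∀ᶠ s in 𝓝 (0 : ℝ), deriv E s * P (E s) = -σ)) := by
  have hJ0 : fderiv ℝ ξ 0 (1, 0) * fderiv ℝ η 0 (0, 1) -
      fderiv ℝ ξ 0 (0, 1) * fderiv ℝ η 0 (1, 0) ≠ 0 := fun h => hσ (by
    rw [← hJ.self_of_nhds, h, zero_mul])
  obtain ⟨hE1, h | h⟩ := deriv_ne_zero_of_mul_eq hξ.differentiableAt hη.differentiableAt hξ0 hη0
    hE.differentiableAt hprod hJ0
  · exact ⟨hE1, Or.inl (deriv_mul_period_eq hP hΨ hg hξ hη hξ0 hη0 hE hprod hJ h.1 h.2 hE1)⟩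
  · refine ⟨hE1, Or.inr ?_⟩
    -- Exchanging X and Y keeps XY and reverses the sign of the Jacobian, which reduces this case to
    -- the other one with −σ.
    let S : (ℝ × ℝ) ≃L[ℝ] ℝ × ℝ := ContinuousLinearEquiv.prodComm ℝ ℝ ℝ
    have hS0 : S 0 = 0 := map_zero S
    have hSt : Tendsto S (𝓝 0) (𝓝 0) := by
      have := S.continuous.tendsto 0
      rwa [hS0] at this
    have hSa : AnalyticAt ℝ S 0 := S.toContinuousLinearMap.analyticAt 0
    have hd : ∀ (φ : ℝ × ℝ → ℝ) (z : ℝ × ℝ) (u v : ℝ),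
        fderiv ℝ (fun w => φ (S w)) z (u, v) = fderiv ℝ φ (S z) (v, u) := by
      intro φ z u v
      have : fderiv ℝ (φ ∘ S) z = _ := S.comp_right_fderiv
      change fderiv ℝ (φ ∘ S) z (u, v) = _
      rw [this]
      rfl
    refine deriv_mul_period_eq (ξ := fun z => ξ (S z)) (η := fun z => η (S z)) hP hΨ hg
      (hξ.comp_of_eq hSa hS0) (hη.comp_of_eq hSa hS0) (by simpa [hS0]) (by simpa [hS0]) hE ?_ ?_
      (by rw [hd, hS0]; exact h.1) (by rw [hd, hS0]; exact h.2) hE1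
    · filter_upwards [hSt.eventually hprod] with z hz
      rw [hz, mul_comm]
      rfl
    · filter_upwards [hSt.eventually hJ] with z hz
      rw [hd, hd, hd, hd, ← hz]
      ring

/-! ### Existence of normalizing coordinates. -/

/-- The Jacobian of `(X, Y) = (x A e^φ, y A e^(-φ))`, where `A` is a function of `x * y`. -/
theorem jacobian_hyperbolic_scaling {A : ℝ → ℝ} {φ : ℝ × ℝ → ℝ} {z : ℝ × ℝ}
    (hA : DifferentiableAt ℝ A (z.1 * z.2)) (hφ : DifferentiableAt ℝ φ z) :
    fderiv ℝ (fun z : ℝ × ℝ => z.1 * A (z.1 * z.2) * Real.exp (φ z)) z (1, 0) *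
      fderiv ℝ (fun z : ℝ × ℝ => z.2 * A (z.1 * z.2) * Real.exp (-φ z)) z (0, 1) -
    fderiv ℝ (fun z : ℝ × ℝ => z.1 * A (z.1 * z.2) * Real.exp (φ z)) z (0, 1) *
      fderiv ℝ (fun z : ℝ × ℝ => z.2 * A (z.1 * z.2) * Real.exp (-φ z)) z (1, 0) =
    (A (z.1 * z.2) ^ 2 + z.1 * z.2 * (2 * A (z.1 * z.2) * deriv A (z.1 * z.2))) *
      (1 + fderiv ℝ φ z (z.1, -z.2)) := by
  have h1 : HasFDerivAt (fun z : ℝ × ℝ => z.1) (ContinuousLinearMap.fst ℝ ℝ ℝ) z := hasFDerivAt_fst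
  have h2 : HasFDerivAt (fun z : ℝ × ℝ => z.2) (ContinuousLinearMap.snd ℝ ℝ ℝ) z := hasFDerivAt_snd
  have hA' : HasFDerivAt (fun z : ℝ × ℝ => A (z.1 * z.2)) _ z :=
    hA.hasDerivAt.comp_hasFDerivAt z (h1.mul h2)
  have hX := (h1.mul hA').mul hφ.hasFDerivAt.exp
  have hY := (h2.mul hA').mul hφ.hasFDerivAt.neg.exp
  have hX' : fderiv ℝ (fun z : ℝ × ℝ => z.1 * A (z.1 * z.2) * Real.exp (φ z)) z = _ := hX.fderiv
  have hY' : fderiv ℝ (fun z : ℝ × ℝ => z.2 * A (z.1 * z.2) * Real.exp (-φ z)) z = _ := hY.fderiv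
  have hexp : Real.exp (φ z) * Real.exp (-φ z) = 1 := by rw [← Real.exp_add]; simp
  rw [hX', hY', apply_eq_fst_mul_add_snd_mul _ (z.1, -z.2)]
  simp
  linear_combination ((A (z.1 * z.2) ^ 2 + z.1 * z.2 * (2 * A (z.1 * z.2) * deriv A (z.1 * z.2))) *
      (1 + (z.1 * fderiv ℝ φ z (1, 0) - z.2 * fderiv ℝ φ z (0, 1)))) * hexp

theorem injective_of_det_ne_zero {A B : ℝ × ℝ →L[ℝ] ℝ}
    (h : A (1, 0) * B (0, 1) - A (0, 1) * B (1, 0) ≠ 0) :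
    Function.Injective (A.prod B : ℝ × ℝ →L[ℝ] ℝ × ℝ) := by
  rw [injective_iff_map_eq_zero]
  intro w hw
  have h1 : A w = 0 := congrArg Prod.fst hw
  have h2 : B w = 0 := congrArg Prod.snd hw
  rw [apply_eq_fst_mul_add_snd_mul] at h1 h2
  have e1 : (A (1, 0) * B (0, 1) - A (0, 1) * B (1, 0)) * w.1 = 0 := by
    linear_combination B (0, 1) * h1 - A (0, 1) * h2
  have e2 : (A (1, 0) * B (0, 1) - A (0, 1) * B (1, 0)) * w.2 = 0 := by
    linear_combination A (1, 0) * h2 - B (1, 0) * h1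
  exact Prod.ext ((mul_eq_zero.1 e1).resolve_left h) ((mul_eq_zero.1 e2).resolve_left h)

/-- An analytic map of the plane with nonzero Jacobian has an analytic local right inverse. -/
theorem exists_analyticAt_rightInverse {F : ℝ × ℝ → ℝ × ℝ} (hF : AnalyticAt ℝ F 0) (hF0 : F 0 = 0)
    (hinj : Function.Injective (fderiv ℝ F 0)) :
    ∃ χ : ℝ × ℝ → ℝ × ℝ, AnalyticAt ℝ χ 0 ∧ χ 0 = 0 ∧ ∀ᶠ w in 𝓝 (0 : ℝ × ℝ), F (χ w) = w := by
  let e : (ℝ × ℝ) ≃L[ℝ] ℝ × ℝ :=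
    (LinearEquiv.ofInjectiveEndo (fderiv ℝ F 0 : ℝ × ℝ →ₗ[ℝ] ℝ × ℝ) hinj).toContinuousLinearEquiv
  have he : (e : ℝ × ℝ →L[ℝ] ℝ × ℝ) = fderiv ℝ F 0 := by
    ext <;> rfl
  have hc : ContDiffAt ℝ ω F 0 := hF.contDiffAt
  have hd : HasFDerivAt F (e : ℝ × ℝ →L[ℝ] ℝ × ℝ) 0 := by
    rw [he]; exact hF.differentiableAt.hasFDerivAt
  have hs : HasStrictFDerivAt F (e : ℝ × ℝ →L[ℝ] ℝ × ℝ) 0 := hc.hasStrictFDerivAt' hd (by simp)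
  refine ⟨hc.localInverse hd (by simp), ?_, ?_, ?_⟩
  · have := (hc.to_localInverse hd (by simp)).analyticAt
    rwa [hF0] at this
  · have := hc.localInverse_apply_image hd (by simp)
    rwa [hF0] at this
  · have := hs.eventually_right_inverse
    rw [hF0] at this
    exact this

/-- Existence of coordinates which make the density constant and preserve the foliation by the
level sets of `x * y`. -/
theorem exists_isochore_coordinates {g Ψ : ℝ × ℝ → ℝ} {P : ℝ → ℝ} (hP : AnalyticAt ℝ P 0)
    (hP0 : 0 < P 0) (hΨ : AnalyticAt ℝ Ψ 0)
    (hg : ∀ᶠ z in 𝓝 (0 : ℝ × ℝ), g z = P (z.1 * z.2) + fderiv ℝ Ψ z (z.1, -z.2)) :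
    ∃ (χ : ℝ × ℝ → ℝ × ℝ) (E : ℝ → ℝ), AnalyticAt ℝ χ 0 ∧ χ 0 = 0 ∧ AnalyticAt ℝ E 0 ∧ E 0 = 0 ∧
      0 < deriv E 0 ∧ (∀ᶠ w in 𝓝 (0 : ℝ × ℝ), (χ w).1 * (χ w).2 = E (w.1 * w.2)) ∧
      ∀ᶠ w in 𝓝 (0 : ℝ × ℝ), ((fderiv ℝ χ w (1, 0)).1 * (fderiv ℝ χ w (0, 1)).2 -
        (fderiv ℝ χ w (0, 1)).1 * (fderiv ℝ χ w (1, 0)).2) * g (χ w) = 1 := by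
  obtain ⟨T, hT, hT0, hTder⟩ := exists_analyticAt_primitive hP
  have hU := analyticAt_dslope hT
  have hU0 : dslope T 0 0 = P 0 := by rw [dslope_same]; exact hTder.self_of_nhds.deriv
  -- T(s)/s is analytic with value P(0) > 0 at 0, so its square root is analytic; this is the factor
  -- with T(s) = s A(s)².
  let A : ℝ → ℝ := fun s => √(dslope T 0 s)
  have hA : AnalyticAt ℝ A 0 := analyticAt_sqrt_comp hU (by rwa [hU0])
  have hTA : ∀ᶠ s in 𝓝 (0 : ℝ), T s = s * A s ^ 2 := by
    have : ∀ᶠ s in 𝓝 (0 : ℝ), 0 < dslope T 0 s :=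
      hU.continuousAt.eventually_const_lt (by rwa [hU0])
    filter_upwards [this] with s hs
    rw [Real.sq_sqrt hs.le]
    have := sub_smul_dslope T 0 s
    rw [sub_zero, hT0, sub_zero, smul_eq_mul] at this
    exact this.symm
  have hmt : Tendsto (fun z : ℝ × ℝ => z.1 * z.2) (𝓝 0) (𝓝 0) := by
    have : Continuous fun z : ℝ × ℝ => z.1 * z.2 := by fun_prop
    simpa using this.tendsto (0 : ℝ × ℝ)
  have hs : AnalyticAt ℝ (fun z : ℝ × ℝ => z.1 * z.2) 0 := analyticAt_fst.mul analyticAt_snd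
  have hPs : AnalyticAt ℝ (fun z : ℝ × ℝ => P (z.1 * z.2)) 0 := hP.comp_of_eq hs (by simp)
  have hAs : AnalyticAt ℝ (fun z : ℝ × ℝ => A (z.1 * z.2)) 0 := hA.comp_of_eq hs (by simp)
  let φ : ℝ × ℝ → ℝ := fun z => Ψ z / P (z.1 * z.2)
  have hφ : AnalyticAt ℝ φ 0 := hΨ.div hPs (by simpa using hP0.ne')
  let X : ℝ × ℝ → ℝ := fun z => z.1 * A (z.1 * z.2) * Real.exp (φ z)
  let Y : ℝ × ℝ → ℝ := fun z => z.2 * A (z.1 * z.2) * Real.exp (-φ z)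
  have hX : AnalyticAt ℝ X 0 := (analyticAt_fst.mul hAs).mul hφ.rexp
  have hY : AnalyticAt ℝ Y 0 := (analyticAt_snd.mul hAs).mul hφ.neg.rexp
  have hPpos : ∀ᶠ s in 𝓝 (0 : ℝ), 0 < P s := hP.continuousAt.eventually_const_lt hP0
  have hdet : ∀ᶠ z in 𝓝 (0 : ℝ × ℝ), fderiv ℝ X z (1, 0) * fderiv ℝ Y z (0, 1) -
      fderiv ℝ X z (0, 1) * fderiv ℝ Y z (1, 0) = g z := by
    filter_upwards [hmt.eventually hA.eventually_analyticAt, hφ.eventually_analyticAt,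
      hΨ.eventually_analyticAt, hmt.eventually hTder, hmt.eventually hTA.eventually_nhds,
      hmt.eventually hPpos, hg] with z h1 h2 h3 h4 h5 h6 h7
    have e1 : P (z.1 * z.2) = A (z.1 * z.2) ^ 2 +
        z.1 * z.2 * (2 * A (z.1 * z.2) * deriv A (z.1 * z.2)) := by
      have hd := (hasDerivAt_id (z.1 * z.2)).mul (h1.differentiableAt.hasDerivAt.pow 2)
      have := h4.unique (hd.congr_of_eventuallyEq h5)
      rw [this]
      simp
    -- P(xy) is constant along the flow, so it passes through the derivative of Ψ = P(xy) φ.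
    have e2 : fderiv ℝ Ψ z (z.1, -z.2) = P (z.1 * z.2) * fderiv ℝ φ z (z.1, -z.2) := by
      have k1 := hasDerivAt_comp_hyperbolic_flow h3.differentiableAt
      have k2 := (hasDerivAt_comp_hyperbolic_flow h2.differentiableAt).const_mul (P (z.1 * z.2))
      refine k1.unique (k2.congr_of_eventuallyEq (Eventually.of_forall fun t => ?_))
      have : z.1 * Real.exp t * (z.2 * Real.exp (-t)) = z.1 * z.2 := by
        rw [mul_mul_mul_comm, ← Real.exp_add]; simp
      simp only [φ, this]
      field_simp
    rw [jacobian_hyperbolic_scaling h1.differentiableAt h2.differentiableAt, ← e1, h7, e2]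
    ring
  have hF : AnalyticAt ℝ (fun z => (X z, Y z)) 0 := hX.prod hY
  have hprodF : ∀ z, DifferentiableAt ℝ X z → DifferentiableAt ℝ Y z →
      fderiv ℝ (fun z => (X z, Y z)) z = (fderiv ℝ X z).prod (fderiv ℝ Y z) := fun z h1 h2 =>
    (h1.hasFDerivAt.prodMk h2.hasFDerivAt).fderiv
  have hg0 : g 0 ≠ 0 := by
    have := hg.self_of_nhds
    rw [this, show ((0 : ℝ × ℝ).1, -(0 : ℝ × ℝ).2) = 0 by simp, map_zero, add_zero]
    simpa using hP0.ne'
  obtain ⟨χ, hχ, hχ0, hinv⟩ := exists_analyticAt_rightInverse hF (by simp [X, Y]) (by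
    rw [hprodF 0 hX.differentiableAt hY.differentiableAt]
    exact injective_of_det_ne_zero (by rw [hdet.self_of_nhds]; exact hg0))
  have hT1 : deriv T 0 ≠ 0 := by rw [hTder.self_of_nhds.deriv]; exact hP0.ne'
  -- Since XY = T(xy), the product xy is the local inverse of T evaluated at XY.
  let E := hT.hasStrictDerivAt.localInverse _ _ _ hT1
  have hE : AnalyticAt ℝ E 0 := by
    have := hT.analyticAt_localInverse hT1
    rwa [hT0] at this
  have hET : ∀ᶠ s in 𝓝 (0 : ℝ), E (T s) = s :=
    (hT.hasStrictDerivAt.hasStrictFDerivAt_equiv hT1).eventually_left_inverse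
  have hE1 : deriv E 0 = (deriv T 0)⁻¹ := by
    have := (hT.hasStrictDerivAt.to_localInverse hT1).hasDerivAt.deriv
    rwa [hT0] at this
  have hχt : Tendsto χ (𝓝 0) (𝓝 0) := by simpa [hχ0] using hχ.continuousAt.tendsto
  refine ⟨χ, E, hχ, hχ0, hE, ?_, ?_, ?_, ?_⟩
  · have := hET.self_of_nhds
    rwa [hT0] at this
  · rw [hE1, hTder.self_of_nhds.deriv]
    exact inv_pos.2 hP0
  · filter_upwards [hinv, (hmt.comp hχt).eventually hTA, (hmt.comp hχt).eventually hET]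
      with w h1 h2 h3
    simp only [Function.comp_apply] at h2 h3
    rw [← h3, h2]
    congr 1
    have e1 : X (χ w) = w.1 := congrArg Prod.fst h1
    have e2 : Y (χ w) = w.2 := congrArg Prod.snd h1
    rw [← e1, ← e2]
    have hexp : Real.exp (φ (χ w)) * Real.exp (-φ (χ w)) = 1 := by rw [← Real.exp_add]; simp
    simp only [X, Y]
    linear_combination -((χ w).1 * (χ w).2 * A ((χ w).1 * (χ w).2) ^ 2) * hexp
  · filter_upwards [hinv.eventually_nhds, hχ.eventually_analyticAt,
      hχt.eventually hX.eventually_analyticAt, hχt.eventually hY.eventually_analyticAt,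
      hχt.eventually hdet] with w h1 h2 h3 h4 h5
    have hc := (h3.differentiableAt.hasFDerivAt.prodMk h4.differentiableAt.hasFDerivAt).comp w
      h2.differentiableAt.hasFDerivAt
    have hid := hc.unique ((hasFDerivAt_id (𝕜 := ℝ) w).congr_of_eventuallyEq h1)
    have k1 := DFunLike.congr_fun hid (1, 0)
    have k2 := DFunLike.congr_fun hid (0, 1)
    have k11 : fderiv ℝ X (χ w) (fderiv ℝ χ w (1, 0)) = 1 := congrArg Prod.fst k1
    have k12 : fderiv ℝ Y (χ w) (fderiv ℝ χ w (1, 0)) = 0 := congrArg Prod.snd k1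
    have k21 : fderiv ℝ X (χ w) (fderiv ℝ χ w (0, 1)) = 0 := congrArg Prod.fst k2
    have k22 : fderiv ℝ Y (χ w) (fderiv ℝ χ w (0, 1)) = 1 := congrArg Prod.snd k2
    rw [apply_eq_fst_mul_add_snd_mul] at k11 k12 k21 k22
    rw [← h5]
    generalize fderiv ℝ χ w (1, 0) = u at *
    generalize fderiv ℝ χ w (0, 1) = v at *
    generalize fderiv ℝ X (χ w) (1, 0) = X₁ at *
    generalize fderiv ℝ X (χ w) (0, 1) = X₂ at *
    generalize fderiv ℝ Y (χ w) (1, 0) = Y₁ at *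
    generalize fderiv ℝ Y (χ w) (0, 1) = Y₂ at *
    linear_combination (v.1 * Y₁ + v.2 * Y₂) * k11 + k22 - (v.1 * X₁ + v.2 * X₂) * k12

/-! ### The rigid body: chart, density and period. -/

/-- Coordinates on the sphere near `(0, ε √(2 l), 0)` in which the Hamiltonian is, up to a
constant, the product of the coordinates. -/
noncomputable def sphereChart (ε k₁ k₃ l : ℝ) (z : ℝ × ℝ) : Fin 3 → ℝ :=
  ![k₁ * (z.1 + z.2),
    ε * √(2 * l - 2 * (k₁ ^ 2 - k₃ ^ 2) * (z.1 * z.2) - (k₁ ^ 2 + k₃ ^ 2) * (z.1 ^ 2 + z.2 ^ 2)),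
    ε * k₃ * (z.1 - z.2)]

theorem casimir_sphereChart {ε k₁ k₃ l : ℝ} (hε : ε ^ 2 = 1) {z : ℝ × ℝ}
    (hz : 0 ≤ 2 * l - 2 * (k₁ ^ 2 - k₃ ^ 2) * (z.1 * z.2) -
      (k₁ ^ 2 + k₃ ^ 2) * (z.1 ^ 2 + z.2 ^ 2)) :
    casimir (sphereChart ε k₁ k₃ l z) = l := by
  simp only [casimir, sphereChart, Matrix.cons_val]
  rw [mul_pow ε, hε, Real.sq_sqrt hz]
  linear_combination (k₃ ^ 2 * (z.1 - z.2) ^ 2 / 2) * hε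

/-- Subtracting L/I₂ removes p₂ and leaves an indefinite quadratic form in p₁, p₃, which splits into
linear factors. The scales k₁, k₃ normalize it to the product of the two chart coordinates. -/
theorem hamiltonian_sub_eq {I₁ I₂ I₃ l k₁ k₃ ε : ℝ} (hk₁ : k₁ ≠ 0) (hk₃ : k₃ ≠ 0)
    (h₁ : 2 * (1 / I₁ - 1 / I₂) * k₁ ^ 2 = 1) (h₃ : 2 * (1 / I₂ - 1 / I₃) * k₃ ^ 2 = 1)
    (hε : ε ^ 2 = 1) {p : Fin 3 → ℝ} (hp : casimir p = l) :
    hamiltonian I₁ I₂ I₃ p - l / I₂ =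
      (p 0 / k₁ + ε * p 2 / k₃) / 2 * ((p 0 / k₁ - ε * p 2 / k₃) / 2) := by
  have e1 : p 0 ^ 2 / k₁ ^ 2 = 2 * (1 / I₁ - 1 / I₂) * p 0 ^ 2 := by
    rw [div_eq_iff (pow_ne_zero 2 hk₁)]
    linear_combination -(p 0 ^ 2) * h₁
  have e3 : p 2 ^ 2 / k₃ ^ 2 = 2 * (1 / I₂ - 1 / I₃) * p 2 ^ 2 := by
    rw [div_eq_iff (pow_ne_zero 2 hk₃)]
    linear_combination -(p 2 ^ 2) * h₃
  have e : (p 0 / k₁ + ε * p 2 / k₃) / 2 * ((p 0 / k₁ - ε * p 2 / k₃) / 2) =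
      (p 0 ^ 2 / k₁ ^ 2 - p 2 ^ 2 / k₃ ^ 2) / 4 := by
    linear_combination (-(p 2 ^ 2 / k₃ ^ 2) / 4) * hε
  rw [e, e1, e3, ← hp, hamiltonian, casimir]
  ring

/-- In the chart dp₃ ∧ dp₁ = 2εk₁k₃ dx ∧ dy, and dividing by 3p₂ = 3ε√(…) gives the model density.
It is stated for an arbitrary parametrization ψ of the sphere, so that it serves both existence and
rigidity; `hpos` selects the sheet of the square root. -/
theorem orbitForm_fderiv_eq {l k₁ k₃ ε : ℝ} (hk₁ : 0 < k₁) (hk₃ : 0 < k₃) (hε : ε ^ 2 = 1)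
    {ψ : ℝ × ℝ → Fin 3 → ℝ} {z : ℝ × ℝ} (hψ : DifferentiableAt ℝ ψ z)
    (hcas : ∀ᶠ w in 𝓝 z, casimir (ψ w) = l) (hpos : 0 < ε * ψ z 1) {ξ η : ℝ × ℝ → ℝ}
    (hξ : ξ = fun w => (ψ w 0 / k₁ + ε * ψ w 2 / k₃) / 2)
    (hη : η = fun w => (ψ w 0 / k₁ - ε * ψ w 2 / k₃) / 2) :
    orbitForm (ψ z) (fderiv ℝ ψ z (1, 0)) (fderiv ℝ ψ z (0, 1)) =
      (fderiv ℝ ξ z (1, 0) * fderiv ℝ η z (0, 1) - fderiv ℝ ξ z (0, 1) * fderiv ℝ η z (1, 0)) *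
      modelDensity (2 * k₁ * k₃ / 3) (2 * l) (k₁ ^ 2 + k₃ ^ 2) (2 * (k₁ ^ 2 - k₃ ^ 2))
        (ξ z, η z) := by
  have hcomp : ∀ i, HasFDerivAt (fun w => ψ w i)
      ((ContinuousLinearMap.proj i : (Fin 3 → ℝ) →L[ℝ] ℝ).comp (fderiv ℝ ψ z)) z := fun i =>
    hasFDerivAt_pi'.1 hψ.hasFDerivAt i
  have htan : ∀ v, ψ z ⬝ᵥ fderiv ℝ ψ z v = 0 := by
    intro v
    have h1 := ((((hcomp 0).pow 2).add ((hcomp 1).pow 2)).add ((hcomp 2).pow 2)).mul_const (2 : ℝ)⁻¹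
    have h2 := h1.unique ((hasFDerivAt_const (𝕜 := ℝ) l z).congr_of_eventuallyEq hcas)
    have h3 := DFunLike.congr_fun h2 v
    simp at h3
    simp only [dotProduct, Fin.sum_univ_three]
    linarith
  have hdξ : ∀ v, fderiv ℝ ξ z v = (fderiv ℝ ψ z v 0 / k₁ + ε * fderiv ℝ ψ z v 2 / k₃) / 2 := by
    intro v
    have h1 := (((hcomp 0).mul_const k₁⁻¹).add (((hcomp 2).const_mul ε).mul_const k₃⁻¹)).mul_const
      (2 : ℝ)⁻¹
    have h2 := h1.congr_of_eventuallyEq (f₁ := ξ) (Eventually.of_forall fun w => by rw [hξ]; rfl)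
    rw [h2.fderiv]
    simp
    ring
  have hdη : ∀ v, fderiv ℝ η z v = (fderiv ℝ ψ z v 0 / k₁ - ε * fderiv ℝ ψ z v 2 / k₃) / 2 := by
    intro v
    have h1 := (((hcomp 0).mul_const k₁⁻¹).sub (((hcomp 2).const_mul ε).mul_const k₃⁻¹)).mul_const
      (2 : ℝ)⁻¹
    have h2 := h1.congr_of_eventuallyEq (f₁ := η) (Eventually.of_forall fun w => by rw [hη]; rfl)
    rw [h2.fderiv]
    simp
    ring
  have hp1 : ψ z 1 ≠ 0 := fun h => by simp [h] at hpos
  have hrad : 2 * l - 2 * (k₁ ^ 2 - k₃ ^ 2) * (ξ z * η z) -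
      (k₁ ^ 2 + k₃ ^ 2) * (ξ z ^ 2 + η z ^ 2) = (ε * ψ z 1) ^ 2 := by
    have h1 : ξ z + η z = ψ z 0 / k₁ := by simp only [hξ, hη]; ring
    have h2 : ξ z - η z = ε * ψ z 2 / k₃ := by simp only [hξ, hη]; ring
    have h3 : 2 * (k₁ ^ 2 - k₃ ^ 2) * (ξ z * η z) + (k₁ ^ 2 + k₃ ^ 2) * (ξ z ^ 2 + η z ^ 2) =
        k₁ ^ 2 * (ξ z + η z) ^ 2 + k₃ ^ 2 * (ξ z - η z) ^ 2 := by ring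
    have h4 : k₁ ^ 2 * (ψ z 0 / k₁) ^ 2 = ψ z 0 ^ 2 := by field_simp
    have h5 : k₃ ^ 2 * (ε * ψ z 2 / k₃) ^ 2 = ψ z 2 ^ 2 := by
      field_simp
      rw [hε, one_mul]
    rw [h1, h2, h4, h5] at h3
    have h6 := hcas.self_of_nhds
    rw [casimir] at h6
    linear_combination -h3 - 2 * h6 - ψ z 1 ^ 2 * hε
  rw [orbitForm_eq_dp₃_dp₁ _ _ _ (htan _) (htan _) hp1, modelDensity, hrad, Real.sqrt_sq hpos.le,
    hdξ, hdξ, hdη, hdη]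
  have hε0 : ε ≠ 0 := fun h => by simp [h] at hε
  field_simp
  ring

open scoped ComplexOrder in
theorem complex_sqrt_neg {N : ℝ} (hN : 0 ≤ N) :
    Complex.sqrt ((-N : ℝ) : ℂ) = Complex.I * (√N : ℝ) := by
  have h : (0 : ℂ) ≤ (N : ℂ) := by exact_mod_cast hN
  rw [Complex.ofReal_neg, Complex.sqrt_neg_of_nonneg h, Complex.sqrt_of_nonneg h,
    Complex.ofReal_re]

/-- The period of the vanishing cycle in terms of the moments of inertia. -/
theorem modelPeriod_eq_ellipticK {a b c l k₁ k₃ s : ℝ} (hab : b < a) (hbc : c < b) (hl : 0 < l)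
    (hk₁ : 0 < k₁) (hk₃ : 0 < k₃)
    (h₁ : 2 * (a - b) * k₁ ^ 2 = 1) (h₃ : 2 * (b - c) * k₃ ^ 2 = 1)
    (hs : 0 < l * (b - c) + s) :
    modelPeriod (2 * k₁ * k₃ / 3) (2 * l) (k₁ ^ 2 + k₃ ^ 2) (2 * (k₁ ^ 2 - k₃ ^ 2)) s =
      1 / (3 * Real.pi) * √(2 / l) * (1 / √((b + s / l - c) * (a - b))) *
        ellipticK ((b + s / l - b) * (a - c) / ((b + s / l - c) * (a - b))) := by
  have hab' : 0 < a - b := sub_pos.2 hab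
  have hbc' : 0 < b - c := sub_pos.2 hbc
  have e₁ : k₁ ^ 2 = 1 / (2 * (a - b)) := by field_simp; linarith
  have e₃ : k₃ ^ 2 = 1 / (2 * (b - c)) := by field_simp; linarith
  have hden : 2 * l - 2 * (k₁ ^ 2 - k₃ ^ 2) * s + 2 * (k₁ ^ 2 + k₃ ^ 2) * s =
      2 * (l * (b - c) + s) / (b - c) := by
    rw [e₁, e₃]; field_simp; ring
  have hN : (b + s / l - c) * (a - b) = (l * (b - c) + s) * (a - b) / l := by
    field_simp; ring
  have hdpos : 0 < 2 * (l * (b - c) + s) / (b - c) := by positivity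
  rw [modelPeriod_eq _ _ _ _ _ (by rw [hden]; exact hdpos), hden, hN]
  have harg : 4 * (k₁ ^ 2 + k₃ ^ 2) * s / (2 * (l * (b - c) + s) / (b - c)) =
      (b + s / l - b) * (a - c) / ((l * (b - c) + s) * (a - b) / l) := by
    rw [e₁, e₃]; field_simp; ring
  -- Both sides are nonnegative, so it suffices to compare squares, where only k₁² and k₃² occur.
  have hcoef : 4 * (k₁ * k₃) / √(2 * (l * (b - c) + s) / (b - c)) =
      √(2 / l) / √((l * (b - c) + s) * (a - b) / l) := by
    rw [← Real.sqrt_div (by positivity), div_eq_iff (Real.sqrt_pos.2 hdpos).ne',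
      ← Real.sqrt_mul (by positivity), eq_comm, Real.sqrt_eq_iff_mul_self_eq (by positivity) (by positivity)]
    have : 4 * (k₁ * k₃) * (4 * (k₁ * k₃)) = 16 * k₁ ^ 2 * k₃ ^ 2 := by ring
    rw [this, e₁, e₃]
    field_simp
    norm_num
  rw [harg]
  linear_combination (ellipticK ((b + s / l - b) * (a - c) / ((l * (b - c) + s) * (a - b) / l)) /
    (3 * Real.pi)) * hcoef

theorem analyticAt_sphereChart {ε k₁ k₃ l : ℝ} (hl : 0 < l) :
    AnalyticAt ℝ (sphereChart ε k₁ k₃ l) 0 := by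
  have hrad : AnalyticAt ℝ (fun z : ℝ × ℝ => 2 * l - 2 * (k₁ ^ 2 - k₃ ^ 2) * (z.1 * z.2) -
      (k₁ ^ 2 + k₃ ^ 2) * (z.1 ^ 2 + z.2 ^ 2)) 0 :=
    (analyticAt_const.sub (analyticAt_const.mul (analyticAt_fst.mul analyticAt_snd))).sub
      (analyticAt_const.mul ((analyticAt_fst.pow 2).add (analyticAt_snd.pow 2)))
  have h0 : AnalyticAt ℝ (fun z => sphereChart ε k₁ k₃ l z 0) 0 :=
    analyticAt_const.mul (analyticAt_fst.add analyticAt_snd)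
  have h1 : AnalyticAt ℝ (fun z => sphereChart ε k₁ k₃ l z 1) 0 :=
    analyticAt_const.mul (analyticAt_sqrt_comp hrad (by simpa))
  have h2 : AnalyticAt ℝ (fun z => sphereChart ε k₁ k₃ l z 2) 0 :=
    analyticAt_const.mul (analyticAt_fst.sub analyticAt_snd)
  refine analyticAt_pi_iff.2 fun i => ?_
  fin_cases i
  exacts [h0, h1, h2]

theorem modelPeriod_zero_pos {l k₁ k₃ α β : ℝ} (hl : 0 < l) (hk₁ : 0 < k₁) (hk₃ : 0 < k₃) :
    0 < modelPeriod (2 * k₁ * k₃ / 3) (2 * l) α β 0 := by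
  rw [modelPeriod_zero]
  positivity

/-- The sphere chart composed with the normalizing coordinates of the model density is a Darboux
parametrization, and l/I₂ + E is the normal form. The sign ε treats both equilibria at once. -/
theorem exists_hyperbolicBirkhoffNormalForm {I₁ I₂ I₃ l k₁ k₃ ε : ℝ} (hl : 0 < l)
    (hk₁ : 0 < k₁) (hk₃ : 0 < k₃) (h₁ : 2 * (1 / I₁ - 1 / I₂) * k₁ ^ 2 = 1)
    (h₃ : 2 * (1 / I₂ - 1 / I₃) * k₃ ^ 2 = 1) (hε : ε ^ 2 = 1) :
    ∃ 𝓗 : ℝ → ℝ, IsHyperbolicBirkhoffNormalForm I₁ I₂ I₃ l ![0, ε * √(2 * l), 0] 𝓗 ∧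
      0 < deriv 𝓗 0 := by
  have hl2 : 0 < 2 * l := by positivity
  obtain ⟨Ψ, hΨ, hg⟩ := exists_modelDensity_decomposition (c := 2 * k₁ * k₃ / 3) (m := 2 * l)
    (α := k₁ ^ 2 + k₃ ^ 2) (β := 2 * (k₁ ^ 2 - k₃ ^ 2)) hl2 (by positivity)
  obtain ⟨χ, E, hχ, hχ0, hE, hE0, hE1, hprod, hJ⟩ := exists_isochore_coordinates
    (analyticAt_modelPeriod hl2) (modelPeriod_zero_pos hl hk₁ hk₃) hΨ hg
  have hχt : Tendsto χ (𝓝 0) (𝓝 0) := by simpa [hχ0] using hχ.continuousAt.tendsto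
  have hψ : AnalyticAt ℝ (fun w => sphereChart ε k₁ k₃ l (χ w)) 0 :=
    (analyticAt_sphereChart hl).comp_of_eq hχ hχ0
  have hrad : ∀ᶠ z in 𝓝 (0 : ℝ × ℝ), 0 < 2 * l - 2 * (k₁ ^ 2 - k₃ ^ 2) * (z.1 * z.2) -
      (k₁ ^ 2 + k₃ ^ 2) * (z.1 ^ 2 + z.2 ^ 2) := by
    have : Continuous fun z : ℝ × ℝ => 2 * l - 2 * (k₁ ^ 2 - k₃ ^ 2) * (z.1 * z.2) -
      (k₁ ^ 2 + k₃ ^ 2) * (z.1 ^ 2 + z.2 ^ 2) := by fun_prop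
    exact this.continuousAt.eventually_const_lt (by simpa)
  have hcas : ∀ᶠ w in 𝓝 (0 : ℝ × ℝ), casimir (sphereChart ε k₁ k₃ l (χ w)) = l := by
    filter_upwards [hχt.eventually hrad] with w hw
    exact casimir_sphereChart hε hw.le
  have hξ : (fun w => (χ w).1) = fun w => (sphereChart ε k₁ k₃ l (χ w) 0 / k₁ +
      ε * sphereChart ε k₁ k₃ l (χ w) 2 / k₃) / 2 := by
    funext w
    simp only [sphereChart, Matrix.cons_val]
    field_simp
    linear_combination -((χ w).1 - (χ w).2) * hε
  have hη : (fun w => (χ w).2) = fun w => (sphereChart ε k₁ k₃ l (χ w) 0 / k₁ -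
      ε * sphereChart ε k₁ k₃ l (χ w) 2 / k₃) / 2 := by
    funext w
    simp only [sphereChart, Matrix.cons_val]
    field_simp
    linear_combination ((χ w).1 - (χ w).2) * hε
  refine ⟨fun t => l / I₂ + E t, ⟨analyticAt_const.add hE, fun w => sphereChart ε k₁ k₃ l (χ w),
    ⟨hψ, ?_, hcas, ?_⟩, ?_⟩, ?_⟩
  · simp [hχ0, sphereChart]
  · filter_upwards [hcas.eventually_nhds, hψ.eventually_analyticAt, hχ.eventually_analyticAt,
      hχt.eventually hrad, hJ] with w h1 h2 h3 h4 h5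
    have hpos : 0 < ε * sphereChart ε k₁ k₃ l (χ w) 1 := by
      simp only [sphereChart, Matrix.cons_val]
      rw [← mul_assoc, ← sq, hε, one_mul]
      exact Real.sqrt_pos.2 h4
    rw [orbitForm_fderiv_eq hk₁ hk₃ hε h2.differentiableAt h1 hpos hξ hη]
    have e1 : ∀ v, fderiv ℝ (fun w => (χ w).1) w v = (fderiv ℝ χ w v).1 := fun v => by
      have h6 := HasFDerivAt.fst h3.differentiableAt.hasFDerivAt
      rw [h6.fderiv]
      rfl
    have e2 : ∀ v, fderiv ℝ (fun w => (χ w).2) w v = (fderiv ℝ χ w v).2 := fun v => by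
      have h6 := HasFDerivAt.snd h3.differentiableAt.hasFDerivAt
      rw [h6.fderiv]
      rfl
    rw [e1, e1, e2, e2]
    exact h5
  · filter_upwards [hcas, hprod] with w h1 h2
    have h3 := hamiltonian_sub_eq (I₁ := I₁) (I₂ := I₂) (I₃ := I₃) hk₁.ne' hk₃.ne' h₁ h₃ hε h1
    have h4 := congrFun hξ w
    have h5 := congrFun hη w
    rw [← h4, ← h5, h2] at h3
    linarith
  · rw [deriv_const_add]
    exact hE1

/-! ### Arbitrary normal forms and their inverses. -/

/-- The derivative of a normal form is, up to sign, the inverse of the period. -/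
theorem IsHyperbolicBirkhoffNormalForm.deriv_mul_period_eq {I₁ I₂ I₃ l k₁ k₃ ε : ℝ} (hl : 0 < l)
    (hk₁ : 0 < k₁) (hk₃ : 0 < k₃) (h₁ : 2 * (1 / I₁ - 1 / I₂) * k₁ ^ 2 = 1)
    (h₃ : 2 * (1 / I₂ - 1 / I₃) * k₃ ^ 2 = 1) (hε : ε ^ 2 = 1) {𝓗 : ℝ → ℝ}
    (h : IsHyperbolicBirkhoffNormalForm I₁ I₂ I₃ l ![0, ε * √(2 * l), 0] 𝓗) :
    𝓗 0 = l / I₂ ∧ deriv 𝓗 0 ≠ 0 ∧ ∃ σ : ℝ, (σ = 1 ∨ σ = -1) ∧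
      ∀ᶠ t in 𝓝 (0 : ℝ), deriv 𝓗 t * modelPeriod (2 * k₁ * k₃ / 3) (2 * l) (k₁ ^ 2 + k₃ ^ 2)
        (2 * (k₁ ^ 2 - k₃ ^ 2)) (𝓗 t - l / I₂) = σ := by
  obtain ⟨h𝓗, ψ, hψ, hH⟩ := h
  have hl2 : 0 < 2 * l := by positivity
  obtain ⟨Ψ, hΨ, hg⟩ := exists_modelDensity_decomposition (c := 2 * k₁ * k₃ / 3) (m := 2 * l)
    (α := k₁ ^ 2 + k₃ ^ 2) (β := 2 * (k₁ ^ 2 - k₃ ^ 2)) hl2 (by positivity)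
  let ξ : ℝ × ℝ → ℝ := fun w => (ψ w 0 / k₁ + ε * ψ w 2 / k₃) / 2
  let η : ℝ × ℝ → ℝ := fun w => (ψ w 0 / k₁ - ε * ψ w 2 / k₃) / 2
  have hψi : ∀ i, AnalyticAt ℝ (fun w => ψ w i) 0 := analyticAt_pi_iff.1 hψ.analyticAt
  have hξ : AnalyticAt ℝ ξ 0 :=
    ((hψi 0).div_const.add (analyticAt_const.mul (hψi 2)).div_const).div_const
  have hη : AnalyticAt ℝ η 0 :=
    ((hψi 0).div_const.sub (analyticAt_const.mul (hψi 2)).div_const).div_const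
  have hξ0 : ξ 0 = 0 := by simp [ξ, hψ.map_zero]
  have hη0 : η 0 = 0 := by simp [η, hψ.map_zero]
  have hprod : ∀ᶠ z in 𝓝 (0 : ℝ × ℝ), ξ z * η z = (fun t => 𝓗 t - l / I₂) (z.1 * z.2) := by
    filter_upwards [hψ.casimir_eq, hH] with z h1 h2
    rw [← hamiltonian_sub_eq (I₁ := I₁) (I₂ := I₂) (I₃ := I₃) hk₁.ne' hk₃.ne' h₁ h₃ hε h1, h2]
  have hpos : ∀ᶠ z in 𝓝 (0 : ℝ × ℝ), 0 < ε * ψ z 1 := by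
    have h0 : 0 < ε * ψ 0 1 := by
      rw [hψ.map_zero]
      simp only [Matrix.cons_val]
      rw [← mul_assoc, ← sq, hε, one_mul]
      exact Real.sqrt_pos.2 hl2
    exact (analyticAt_const.mul (hψi 1)).continuousAt.eventually_const_lt h0
  have hJ : ∀ᶠ z in 𝓝 (0 : ℝ × ℝ), (fderiv ℝ ξ z (1, 0) * fderiv ℝ η z (0, 1) -
      fderiv ℝ ξ z (0, 1) * fderiv ℝ η z (1, 0)) * modelDensity (2 * k₁ * k₃ / 3) (2 * l)
        (k₁ ^ 2 + k₃ ^ 2) (2 * (k₁ ^ 2 - k₃ ^ 2)) (ξ z, η z) = 1 := by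
    filter_upwards [hψ.casimir_eq.eventually_nhds, hψ.analyticAt.eventually_analyticAt, hpos,
      hψ.pullback_eq] with z h1 h2 h3 h4
    exact (orbitForm_fderiv_eq hk₁ hk₃ hε h2.differentiableAt h1 h3 rfl rfl).symm.trans h4
  have hE : AnalyticAt ℝ (fun t => 𝓗 t - l / I₂) 0 := h𝓗.sub analyticAt_const
  have h0 : 𝓗 0 = l / I₂ := by
    have := hprod.self_of_nhds
    rw [hξ0, zero_mul] at this
    exact sub_eq_zero.1 (by simpa using this.symm)
  have hd : ∀ t, deriv (fun t => 𝓗 t - l / I₂) t = deriv 𝓗 t := fun t => deriv_sub_const _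
  obtain ⟨hE1, hcase⟩ := deriv_mul_period_eq_or_neg (analyticAt_modelPeriod hl2) hΨ hg hξ hη hξ0
    hη0 hE hprod one_ne_zero hJ
  simp only [hd] at hE1 hcase
  refine ⟨h0, hE1, ?_⟩
  rcases hcase with hc | hc
  · exact ⟨1, Or.inl rfl, hc⟩
  · exact ⟨-1, Or.inr rfl, hc⟩

/-- A left inverse of a function with nonzero derivative near a point is differentiable there. -/
theorem hasDerivAt_of_leftInverse {f Φ : ℝ → ℝ} (hf : AnalyticAt ℝ f 0) (hf' : deriv f 0 ≠ 0)
    (hΦ : ∀ᶠ t in 𝓝 (0 : ℝ), Φ (f t) = t) {p : ℝ → Prop} (hp : ∀ᶠ t in 𝓝 (0 : ℝ), p t) :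
    ∀ᶠ h in 𝓝 (f 0), p (Φ h) ∧ f (Φ h) = h ∧ HasDerivAt Φ (deriv f (Φ h))⁻¹ h := by
  let G := hf.hasStrictDerivAt.localInverse _ _ _ hf'
  have hs := hf.hasStrictDerivAt.hasStrictFDerivAt_equiv hf'
  have hright : ∀ᶠ h in 𝓝 (f 0), f (G h) = h := hs.eventually_right_inverse
  have hG0 : G (f 0) = 0 := hs.localInverse_apply_image
  have hGa : AnalyticAt ℝ G (f 0) := hf.analyticAt_localInverse hf'
  have hGt : Tendsto G (𝓝 (f 0)) (𝓝 0) := by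
    have := hGa.continuousAt.tendsto
    rwa [hG0] at this
  -- Any left inverse agrees with the local inverse G near f(0), because Φ(h) = Φ(f(G h)) = G h.
  have heq : ∀ᶠ h in 𝓝 (f 0), Φ h = G h := by
    filter_upwards [hright, hGt.eventually hΦ] with h h1 h2
    rwa [h1] at h2
  have hne : ∀ᶠ t in 𝓝 (0 : ℝ), deriv f t ≠ 0 := hf.deriv.continuousAt.eventually_ne hf'
  filter_upwards [heq.eventually_nhds, hright.eventually_nhds, hGa.eventually_analyticAt,
    hGt.eventually hf.eventually_analyticAt, hGt.eventually hne, hGt.eventually hp]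
    with h h1 h2 h3 h4 h5 h6
  have e := h1.self_of_nhds
  refine ⟨by rwa [e], by rw [e]; exact h2.self_of_nhds, ?_⟩
  have h7 : HasDerivAt G (deriv f (G h))⁻¹ h :=
    h4.differentiableAt.hasDerivAt.of_local_left_inverse h3.continuousAt h5 h2
  rw [e]
  exact h7.congr_of_eventuallyEq h1

end FreeRigidBody

theorem theorem4p4 (I₁ I₂ I₃ l : ℝ) (hI₁ : 0 < I₁) (hI₁₂ : I₁ < I₂) (hI₂₃ : I₂ < I₃) (hl : 0 < l)
    (P₀ : Fin 3 → ℝ) (hP₀ : P₀ = ![0, √(2 * l), 0] ∨ P₀ = ![0, -√(2 * l), 0]) :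
    (∃ 𝓗 : ℝ → ℝ, FreeRigidBody.IsHyperbolicBirkhoffNormalForm I₁ I₂ I₃ l P₀ 𝓗 ∧
      0 < deriv 𝓗 0) ∧
    ∀ 𝓗 : ℝ → ℝ, FreeRigidBody.IsHyperbolicBirkhoffNormalForm I₁ I₂ I₃ l P₀ 𝓗 →
      𝓗 0 = l / I₂ ∧ deriv 𝓗 0 ≠ 0 ∧
      ∀ Φ : ℝ → ℝ, (∀ᶠ t in 𝓝 (0 : ℝ), Φ (𝓗 t) = t) →
        ∀ᶠ h in 𝓝 (l / I₂),
          let a : ℝ := 1 / I₁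
          let b : ℝ := 1 / I₂
          let c : ℝ := 1 / I₃
          let d : ℝ := h / l
          let value : ℂ := Complex.I / (3 * (Real.pi : ℂ)) * (√(2 / l) : ℝ) *
            (1 / Complex.sqrt (((d - c) * (b - a) : ℝ) : ℂ)) *
            (FreeRigidBody.ellipticK ((d - b) * (a - c) / ((d - c) * (a - b))) : ℝ)
          HasDerivAt (fun x : ℝ => (Φ x : ℂ)) (((SignType.sign (deriv 𝓗 0) : ℝ) : ℂ) * value) h ∧
            value = -Complex.I * FreeRigidBody.S l b a c d := by
  have ha : 1 / I₂ < 1 / I₁ := one_div_lt_one_div_of_lt hI₁ hI₁₂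
  have hc : 1 / I₃ < 1 / I₂ := one_div_lt_one_div_of_lt (hI₁.trans hI₁₂) hI₂₃
  have hscale : ∀ u : ℝ, 0 < u → ∃ k : ℝ, 0 < k ∧ 2 * u * k ^ 2 = 1 := fun u hu =>
    ⟨√(1 / (2 * u)), by positivity, by rw [Real.sq_sqrt (by positivity)]; field_simp⟩
  obtain ⟨k₁, hk₁, h₁⟩ := hscale _ (sub_pos.2 ha)
  obtain ⟨k₃, hk₃, h₃⟩ := hscale _ (sub_pos.2 hc)
  obtain ⟨ε, hε, rfl⟩ : ∃ ε : ℝ, ε ^ 2 = 1 ∧ P₀ = ![0, ε * √(2 * l), 0] := by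
    rcases hP₀ with rfl | rfl
    · exact ⟨1, by norm_num, by simp⟩
    · exact ⟨-1, by norm_num, by simp⟩
  refine ⟨FreeRigidBody.exists_hyperbolicBirkhoffNormalForm hl hk₁ hk₃ h₁ h₃ hε, fun 𝓗 h => ?_⟩
  obtain ⟨h0, hne, σ, hσ, hper⟩ := h.deriv_mul_period_eq hl hk₁ hk₃ h₁ h₃ hε
  refine ⟨h0, hne, fun Φ hΦ => ?_⟩
  -- At t = 0 the relation reads 𝓗'(0) P(0) = σ with P(0) > 0.
  have hsign : (SignType.sign (deriv 𝓗 0) : ℝ) = σ := by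
    have h1 := hper.self_of_nhds
    rw [h0, sub_self] at h1
    have h2 := FreeRigidBody.modelPeriod_zero_pos (α := k₁ ^ 2 + k₃ ^ 2)
      (β := 2 * (k₁ ^ 2 - k₃ ^ 2)) hl hk₁ hk₃
    rcases hσ with rfl | rfl
    · rw [sign_pos (pos_of_mul_pos_left (by rw [h1]; norm_num) h2.le)]
      simp
    · rw [sign_neg (neg_of_mul_neg_left (by rw [h1]; norm_num) h2.le)]
      simp
  have hinv := FreeRigidBody.hasDerivAt_of_leftInverse h.1 hne hΦ hper
  rw [h0] at hinv
  have hnear : ∀ᶠ x in 𝓝 (l / I₂), 0 < l * (1 / I₂ - 1 / I₃) + (x - l / I₂) := by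
    have hcont : Continuous fun x : ℝ => l * (1 / I₂ - 1 / I₃) + (x - l / I₂) := by fun_prop
    refine hcont.continuousAt.eventually_const_lt ?_
    have := mul_pos hl (sub_pos.2 hc)
    simpa using this
  filter_upwards [hinv, hnear] with x hx hpos
  obtain ⟨hx1, hx2, hx3⟩ := hx
  intro a b c d value
  rw [hx2] at hx1
  have hd : b + (x - l / I₂) / l = d := by
    simp only [b, d]
    field_simp
    ring
  have hP := FreeRigidBody.modelPeriod_eq_ellipticK (a := a) (b := b) (c := c) ha hc hl hk₁ hk₃ h₁
    h₃ hpos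
  rw [hd] at hP
  have hN : 0 ≤ (d - c) * (a - b) := by
    have h1 : d - c = (l * (1 / I₂ - 1 / I₃) + (x - l / I₂)) / l := by
      rw [← hd]
      simp only [b, c]
      field_simp
      ring
    rw [h1]
    exact mul_nonneg (div_nonneg hpos.le hl.le) (sub_nonneg.2 ha.le)
  -- The radicand is nonpositive, so its principal root is i times a real root; this i cancels the
  -- one in the numerator and `value` is real.
  have hsqrt : Complex.sqrt (((d - c) * (b - a) : ℝ) : ℂ) =
      Complex.I * (√((d - c) * (a - b)) : ℝ) := by
    rw [← FreeRigidBody.complex_sqrt_neg hN]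
    congr 2
    ring
  constructor
  · have hvalue : (((SignType.sign (deriv 𝓗 0) : ℝ) : ℂ) * value) =
        (((deriv 𝓗 (Φ x))⁻¹ : ℝ) : ℂ) := by
      have h1 : (deriv 𝓗 (Φ x))⁻¹ = σ * FreeRigidBody.modelPeriod (2 * k₁ * k₃ / 3) (2 * l)
          (k₁ ^ 2 + k₃ ^ 2) (2 * (k₁ ^ 2 - k₃ ^ 2)) (x - l / I₂) := by
        have h3 : σ * σ = 1 := by rcases hσ with rfl | rfl <;> norm_num
        -- Since σ² = 1, the relation 𝓗' P = σ gives 1/𝓗' = σP.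
        exact inv_eq_of_mul_eq_one_right (by linear_combination σ * hx1 + h3)
      rw [h1, hP, hsign]
      simp only [value]
      rw [hsqrt]
      push_cast
      have hI : Complex.I * (1 / (Complex.I * (√((d - c) * (a - b)) : ℝ))) =
          1 / ((√((d - c) * (a - b)) : ℝ) : ℂ) := by
        rw [one_div, mul_inv, mul_inv_cancel_left₀ Complex.I_ne_zero, one_div]
      linear_combination (σ * (1 / (3 * (Real.pi : ℂ))) * (√(2 / l) : ℝ) *
        (FreeRigidBody.ellipticK ((d - b) * (a - c) / ((d - c) * (a - b))) : ℝ)) * hI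
    rw [hvalue]
    exact hx3.ofReal_comp
  · simp only [value, FreeRigidBody.S]
    ring
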